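/- Let $G$ be a (finite-dimensional, real, smooth) Lie group with identity $e$, $\mathfrak g=T_eG$, and let $R_g$ denote right translation. Put $Ad_g=T_eI_g$ with $I_g(h)=g^{-1}hg$, let $ad_\xi\eta=[\xi,\eta]$ be the derivative of $g\mapsto Ad_g\eta$ at $e$ in the direction $\xi$ (so that $[\xi,\eta]$ corresponds to the Jacobi–Lie bracket of right-invariant vector fields), and let $\langle Ad^*_g\mu,\xi\rangle=\langle\mu,Ad_{g^{-1}}\xi\rangle$, $\langle ad^*_\xi\mu,\eta\rangle=\langle\mu,[\xi,\eta]\rangle$. Let $G\circledS\mathfrak g$ be $G\times\mathfrak g$, and let ${}^1T^*TG=(G\circledS\mathfrak g)\circledS(\mathfrak g^*\times\mathfrak g^*)$, with points $(g,\xi,\mu,\nu)$ and multiplication $$(g,\xi,\mu_1,\mu_2)(h,\eta,\nu_1,\nu_2)=\bigl(gh,\ \xi+Ad_{g^{-1}}\eta,\ \mu_1+Ad^*_{g^{-1}}(\nu_1+ad^*_{Ad_g\xi}\nu_2),\ \mu_2+Ad^*_{g^{-1}}\nu_2\bigr).$$ Let $\theta$ be the canonical one-form on $T^*(G\circledS\mathfrak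 g)$, and let $\theta_{{}^1T^*TG}$ and $\Omega_{{}^1T^*TG}$ be the forms on ${}^1T^*TG$ that correspond to $\theta$ and to the symplectic form $\Omega=d\theta$ under the bijective trivialization $$T^*(G\circledS\mathfrak g)\to{}^1T^*TG,\qquad (\alpha_g,\alpha_\xi)\in T^*_{(g,\xi)}(G\circledS\mathfrak g)\ \mapsto\ (g,\ \xi,\ T_e^*R_g\alpha_g+ad^*_\xi\alpha_\xi,\ \alpha_\xi).$$ Let $X_{(\eta,\zeta,\lambda_1,\lambda_2)}$ be the right-invariant vector field on ${}^1T^*TG$ generated by $(\eta,\zeta,\lambda_1,\lambda_2)\in\mathfrak g\times\mathfrak g\times\mathfrak g^*\times\mathfrak g^*$, i.e. the image of this vector under the tangent map at the identity $(e,0,0,0)$ of right translation. Then: 1. $X_{(\eta,\zeta,\lambda_1,\lambda_2)}(g,\xi,\mu,\nu)=\bigl(T_eR_g\eta,\ \zeta+[\xi,\eta],\ \lambda_1+ad^*_\eta\mu+ad^*_\zeta\nu,\ \lambda_2+ad^*_\eta\nu\bigr)$. 2. At $(g,\xi,\mu,\nu)$, $\ \langle\theta_{{}^1T^*TG};X_{(\eta,\zeta,\lambda_1,\lambda_2)}\rangle=\langle\mu,\eta\rangle+\langle\nu,\zeta\rangle$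 and $$\Omega_{{}^1T^*TG}\bigl(X_{(\eta,\zeta,\lambda_1,\lambda_2)},X_{(\bar\eta,\bar\zeta,\bar\lambda_1,\bar\lambda_2)}\bigr)=\langle\lambda_1,\bar\eta\rangle+\langle\lambda_2,\bar\zeta\rangle-\langle\bar\lambda_1,\eta\rangle-\langle\bar\lambda_2,\zeta\rangle+\langle\mu,[\eta,\bar\eta]\rangle+\langle\nu,[\eta,\bar\zeta]-[\bar\eta,\zeta]\rangle .$$ 3. For every differentiable $H:{}^1T^*TG\to\mathbb R$ there is exactly one vector field $X_H$ with $i_{X_H}\Omega_{{}^1T^*TG}=-dH$; its value at $(g,\xi,\mu,\nu)$ is the value there of the right-invariant vector field generated by $$\Bigl(\tfrac{\delta H}{\delta\mu},\ \tfrac{\delta H}{\delta\nu},\ -T_e^*R_g\tfrac{\delta H}{\delta g}-ad^*_\xi\tfrac{\delta H}{\delta\xi},\ -\tfrac{\delta H}{\delta\xi}\Bigr),$$ where the partial derivatives are taken at $(g,\xi,\mu,\nu)$, $\frac{\delta H}{\delta g}\in T_g^*G$, $\frac{\delta H}{\delta\xi}\in\mathfrak g^*$, and $\frac{\delta H}{\delta\mu},\frac{\delta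 H}{\delta\nu}\in\mathfrak g^{**}=\mathfrak g$. A curve $(g,\xi,\mu,\nu)$ in ${}^1T^*TG$ is an integral curve of $X_H$ (on any set of times) if and only if there it satisfies the trivialized Hamilton's equations $$\frac{dg}{dt}=T_eR_g\frac{\delta H}{\delta\mu},\qquad \frac{d\xi}{dt}=\frac{\delta H}{\delta\nu}+ad_\xi\frac{\delta H}{\delta\mu},$$ $$\frac{d\mu}{dt}=-T_e^*R_g\frac{\delta H}{\delta g}-ad^*_\xi\frac{\delta H}{\delta\xi}+ad^*_{\frac{\delta H}{\delta\mu}}\mu+ad^*_{\frac{\delta H}{\delta\nu}}\nu,\qquad \frac{d\nu}{dt}=-\frac{\delta H}{\delta\xi}+ad^*_{\frac{\delta H}{\delta\mu}}\nu .$$ -/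

import Mathlib

open scoped Manifold ContDiff
open Bundle

noncomputable section

namespace TrivializedHamilton

/-! ### The cotangent bundle of a manifold and its canonical forms -/

section Cotangent

variable {V : Type*} [NormedAddCommGroup V] [NormedSpace ℝ V]
  {H : Type*} [TopologicalSpace H] (I : ModelWithCorners ℝ V H)
  (M : Type*) [TopologicalSpace M] [ChartedSpace H M]

/-- The cotangent bundle `T*M`, with the topology and the charts of the vector bundle of
continuous linear maps from `TM` to the trivial line bundle. Points are pairs `⟨x, α⟩` with
`α` a continuous linear form on the tangent space at `x`. -/
abbrev CotangentBundle : Type _ :=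
  TotalSpace (V →L[ℝ] ℝ) (fun x : M => TangentSpace I x →L[ℝ] Trivial M ℝ x)

/-- The type of differential one-forms on `M` (no regularity is imposed). -/
abbrev OneForm : Type _ := ∀ x : M, TangentSpace I x →L[ℝ] ℝ

/-- The type of differential two-forms on `M` (no regularity is imposed). -/
abbrev TwoForm : Type _ := ∀ x : M, TangentSpace I x [⋀^Fin 2]→L[ℝ] ℝ

variable {I M}

/-- The local expression, in the preferred chart at `x`, of a one-form on a manifold without
boundary: the pullback of the form by the inverse of the chart. -/
def inChart [I.Boundaryless] (θ : OneForm I M) (x : M) : V → V [⋀^Fin 1]→L[ℝ] ℝ :=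
  fun y => ContinuousAlternatingMap.ofSubsingleton ℝ V ℝ (0 : Fin 1)
    ((θ ((extChartAt I x).symm y)).comp (mfderiv 𝓘(ℝ, V) I (extChartAt I x).symm y))

/-- The exterior derivative of a one-form on a manifold without boundary: at `x`, differentiate
the local expression in the chart at `x` and transport the result back. The normalization is
`dθ(X, Y) = X (θ Y) - Y (θ X) - θ [X, Y]`. -/
def extDerivOneForm [I.Boundaryless] (θ : OneForm I M) : TwoForm I M := fun x =>
  (extDeriv (inChart θ x) (extChartAt I x x)).compContinuousLinearMap
    (mfderiv I 𝓘(ℝ, V) (extChartAt I x) x)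

variable [IsManifold I 1 M]

variable (I M) in
/-- The canonical (Liouville) one-form on `T*M`: `θ_α(w) = α(Tπ w)`. -/
def canonicalOneForm : OneForm (I.prod 𝓘(ℝ, V →L[ℝ] ℝ)) (CotangentBundle I M) := fun α =>
  (show TangentSpace I α.proj →L[ℝ] ℝ from α.snd).comp
    (mfderiv (I.prod 𝓘(ℝ, V →L[ℝ] ℝ)) I (fun β : CotangentBundle I M => β.proj) α)

variable (I M) in
/-- The canonical symplectic form `Ω = dθ` on `T*M`. -/
def canonicalTwoForm [I.Boundaryless] :
    TwoForm (I.prod 𝓘(ℝ, V →L[ℝ] ℝ)) (CotangentBundle I M) :=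
  extDerivOneForm (canonicalOneForm I M)

end Cotangent

/-! ### A Lie group with the right-invariant conventions -/

/-- The Lie algebra `𝔤 = T_e G`. The tangent space `TangentSpace 𝓘(ℝ, E) (1 : G)` is by definition
the model space `E`; it is spelled as `E` here so that `𝔤` is a normed space. -/
abbrev LieAlg (_G : Type*) (E : Type*) : Type _ := E

/-- The dual `𝔤*` of the Lie algebra. -/
abbrev LieAlgDual (G E : Type*) [NormedAddCommGroup E] [NormedSpace ℝ E] : Type _ :=
  LieAlg G E →L[ℝ] ℝ

section LieGroupConventions

variable {E : Type*} [NormedAddCommGroup E] [NormedSpace ℝ E]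
  {G : Type*} [TopologicalSpace G] [ChartedSpace E G] [Group G]

/-- `T_e R_g : 𝔤 → T_g G`, the tangent map at the identity of right translation by `g`. -/
def TR (g : G) : LieAlg G E →L[ℝ] TangentSpace 𝓘(ℝ, E) g :=
  mfderiv 𝓘(ℝ, E) 𝓘(ℝ, E) (fun h : G => h * g) 1

/-- `T_g R_{g⁻¹} : T_g G → 𝔤`. -/
def TRinv (g : G) : TangentSpace 𝓘(ℝ, E) g →L[ℝ] LieAlg G E :=
  mfderiv 𝓘(ℝ, E) 𝓘(ℝ, E) (fun h : G => h * g⁻¹) g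

/-- The right adjoint action `Ad_g = T_e I_g`, where `I_g h = g⁻¹ h g`. -/
def Ad (g : G) : LieAlg G E →L[ℝ] LieAlg G E :=
  mfderiv 𝓘(ℝ, E) 𝓘(ℝ, E) (fun h : G => g⁻¹ * h * g) 1

variable (G) in
/-- The infinitesimal right adjoint representation `ad_ξ η = [ξ, η]`, the derivative of
`g ↦ Ad_g` at the identity. With these conventions `[ξ, η]` corresponds to the Jacobi-Lie bracket
of the right-invariant vector fields of `ξ` and `η`. -/
def ad : LieAlg G E →L[ℝ] LieAlg G E →L[ℝ] LieAlg G E :=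
  mfderiv 𝓘(ℝ, E) 𝓘(ℝ, E →L[ℝ] E) (fun g : G => (Ad g : LieAlg G E →L[ℝ] LieAlg G E)) 1

/-- The coadjoint action: `⟨Ad*_g μ, ξ⟩ = ⟨μ, Ad_{g⁻¹} ξ⟩`. -/
def AdStar (g : G) (μ : LieAlgDual G E) : LieAlgDual G E := μ.comp (Ad g⁻¹)

variable (G) in
/-- The infinitesimal coadjoint action, dual to `ad`: `⟨ad*_ξ μ, η⟩ = ⟨μ, [ξ, η]⟩`. -/
def adStar (ξ : LieAlg G E) (μ : LieAlgDual G E) : LieAlgDual G E := μ.comp (ad G ξ)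

/-! ### The first-kind trivialization of `T*(G ⋉ 𝔤)` -/

variable (E G) in
/-- The manifold underlying the tangent group `G ⋉ 𝔤`. -/
abbrev TangentGroup : Type _ := G × LieAlg G E

variable (E) in
/-- The model of `G ⋉ 𝔤`. -/
abbrev tgModel : ModelWithCorners ℝ (E × E) (ModelProd E E) := 𝓘(ℝ, E).prod 𝓘(ℝ, E)

variable (E) in
/-- The model of `T*(G ⋉ 𝔤)`. -/
abbrev ctModel : ModelWithCorners ℝ ((E × E) × (E × E →L[ℝ] ℝ))
    (ModelProd (ModelProd E E) (E × E →L[ℝ] ℝ)) := (tgModel E).prod 𝓘(ℝ, E × E →L[ℝ] ℝ)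

variable (E G) in
/-- The trivialized space `¹T*TG = (G ⋉ 𝔤) ⋉ (𝔤* × 𝔤*)`; its points are `((g, ξ), (μ, ν))`. -/
abbrev Triv : Type _ := TangentGroup E G × (LieAlgDual G E × LieAlgDual G E)

variable (E) in
/-- The model of `¹T*TG`. -/
abbrev trivModel : ModelWithCorners ℝ ((E × E) × ((E →L[ℝ] ℝ) × (E →L[ℝ] ℝ)))
    (ModelProd (ModelProd E E) (ModelProd (E →L[ℝ] ℝ) (E →L[ℝ] ℝ))) :=
  (tgModel E).prod (𝓘(ℝ, E →L[ℝ] ℝ).prod 𝓘(ℝ, E →L[ℝ] ℝ))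

/-- The group multiplication on `¹T*TG`:
`(g, ξ, μ₁, μ₂) (h, η, ν₁, ν₂) = (g h, ξ + Ad_{g⁻¹} η,
μ₁ + Ad*_{g⁻¹} (ν₁ + ad*_{Ad_g ξ} ν₂), μ₂ + Ad*_{g⁻¹} ν₂)`. -/
def trivMul (p q : Triv E G) : Triv E G :=
  ((p.1.1 * q.1.1, p.1.2 + Ad p.1.1⁻¹ q.1.2),
    (p.2.1 + AdStar p.1.1⁻¹ (q.2.1 + adStar G (Ad p.1.1 p.1.2) q.2.2),
      p.2.2 + AdStar p.1.1⁻¹ q.2.2))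

variable (E G) in
/-- The identity element of `¹T*TG`. -/
def trivOne : Triv E G := ((1, 0), (0, 0))

/-- The right-invariant vector field on `¹T*TG` generated by `(η, ζ, λ₁, λ₂)` in its Lie algebra:
at `p` it is the image of the generator under the tangent map at the identity of right translation
by `p`. -/
def rightInvariantField (η ζ : LieAlg G E) (l₁ l₂ : LieAlgDual G E) (p : Triv E G) :
    TangentSpace (trivModel E) p :=
  mfderiv (trivModel E) (trivModel E) (fun q : Triv E G => trivMul q p) (trivOne E G)
    (((η, ζ), (l₁, l₂)) : (E × E) × ((E →L[ℝ] ℝ) × (E →L[ℝ] ℝ)))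

variable [LieGroup 𝓘(ℝ, E) ∞ G]

theorem TRinv_TR (g : G) (η : LieAlg G E) : TRinv g (TR g η) = η := by
  have hd : ∀ a x : G, MDifferentiableAt 𝓘(ℝ, E) 𝓘(ℝ, E) (fun h : G => h * a) x := fun a x =>
    (contMDiff_mul_right (I := 𝓘(ℝ, E)) (n := ∞) (a := a)).contMDiffAt.mdifferentiableAt (by simp)
  have key : mfderiv 𝓘(ℝ, E) 𝓘(ℝ, E) ((fun h : G => h * g⁻¹) ∘ (fun h : G => h * g)) 1 =
      ContinuousLinearMap.id ℝ (TangentSpace 𝓘(ℝ, E) (1 : G)) := by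
    have : (fun h : G => h * g⁻¹) ∘ (fun h : G => h * g) = id := by ext x; simp
    rw [this, mfderiv_id]
  rw [mfderiv_comp (I' := 𝓘(ℝ, E)) _ (hd _ _) (hd _ _)] at key
  have h1 := DFunLike.congr_fun key η
  have e : (1 : G) * g = g := one_mul g
  have h2 : mfderiv 𝓘(ℝ, E) 𝓘(ℝ, E) (fun h : G => h * g⁻¹) (1 * g)
      (mfderiv 𝓘(ℝ, E) 𝓘(ℝ, E) (fun h : G => h * g) 1 η) = η := h1
  rw [e] at h2
  exact h2

theorem TR_TRinv (g : G) (v : TangentSpace 𝓘(ℝ, E) g) : TR g (TRinv g v) = v := by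
  have hd : ∀ a x : G, MDifferentiableAt 𝓘(ℝ, E) 𝓘(ℝ, E) (fun h : G => h * a) x := fun a x =>
    (contMDiff_mul_right (I := 𝓘(ℝ, E)) (n := ∞) (a := a)).contMDiffAt.mdifferentiableAt (by simp)
  have key : mfderiv 𝓘(ℝ, E) 𝓘(ℝ, E) ((fun h : G => h * g) ∘ (fun h : G => h * g⁻¹)) g =
      ContinuousLinearMap.id ℝ (TangentSpace 𝓘(ℝ, E) g) := by
    have : (fun h : G => h * g) ∘ (fun h : G => h * g⁻¹) = id := by ext x; simp
    rw [this, mfderiv_id]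
  rw [mfderiv_comp (I' := 𝓘(ℝ, E)) _ (hd _ _) (hd _ _)] at key
  have h1 := DFunLike.congr_fun key v
  have e : g * g⁻¹ = 1 := mul_inv_cancel g
  have h2 : mfderiv 𝓘(ℝ, E) 𝓘(ℝ, E) (fun h : G => h * g) (g * g⁻¹)
      (mfderiv 𝓘(ℝ, E) 𝓘(ℝ, E) (fun h : G => h * g⁻¹) g v) = v := h1
  rw [e] at h2
  exact h2

/-- The first-kind trivialization `T*(G ⋉ 𝔤) → (G ⋉ 𝔤) ⋉ (𝔤* × 𝔤*)`,
`(α_g, α_ξ) ↦ (g, ξ, T_e^* R_g α_g + ad*_ξ α_ξ, α_ξ)`. Its inverse is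
`(g, ξ, μ, ν) ↦ ((μ - ad*_ξ ν) ∘ T_g R_{g⁻¹}, ν)`, a covector at `(g, ξ)`. -/
def trivialization : CotangentBundle (tgModel E) (TangentGroup E G) ≃ Triv E G where
  toFun α :=
    let αg : TangentSpace 𝓘(ℝ, E) α.proj.1 →L[ℝ] ℝ :=
      (show E × E →L[ℝ] ℝ from α.snd).comp (ContinuousLinearMap.inl ℝ E E)
    let αξ : LieAlgDual G E :=
      (show E × E →L[ℝ] ℝ from α.snd).comp (ContinuousLinearMap.inr ℝ E E)
    (α.proj, (αg.comp (TR α.proj.1) + adStar G α.proj.2 αξ, αξ))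
  invFun p := ⟨p.1,
    (show E × E →L[ℝ] ℝ from
      ((p.2.1 - adStar G p.1.2 p.2.2).comp
        (show E →L[ℝ] E from TRinv p.1.1)).comp (ContinuousLinearMap.fst ℝ E E) +
      p.2.2.comp (ContinuousLinearMap.snd ℝ E E))⟩
  left_inv := by
    rintro ⟨⟨g, ξ⟩, α⟩
    refine congrArg (fun β => (⟨(g, ξ), β⟩ : CotangentBundle (tgModel E) (TangentGroup E G))) ?_
    refine ContinuousLinearMap.ext fun w => ?_
    obtain ⟨v, z⟩ := (show E × E from w)
    have h := TR_TRinv g v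
    set a : E × E →L[ℝ] ℝ := α with ha
    change (a (TR g (TRinv g v), 0) + adStar G ξ (a.comp (ContinuousLinearMap.inr ℝ E E))
        (TRinv g v) - adStar G ξ (a.comp (ContinuousLinearMap.inr ℝ E E)) (TRinv g v)) + a (0, z) = a (v, z)
    rw [h, add_sub_cancel_right, ← map_add]
    simp
  right_inv := by
    rintro ⟨⟨g, ξ⟩, μ, ν⟩
    have h2 : ((show E × E →L[ℝ] ℝ from
      ((μ - adStar G ξ ν).comp
        (show E →L[ℝ] E from TRinv g)).comp (ContinuousLinearMap.fst ℝ E E) +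
      ν.comp (ContinuousLinearMap.snd ℝ E E))).comp (ContinuousLinearMap.inr ℝ E E) = ν := by
      ext z; simp
    refine Prod.ext rfl (Prod.ext ?_ h2)
    refine ContinuousLinearMap.ext fun η => ?_
    have h := TRinv_TR g η
    have h3 := DFunLike.congr_fun h2 η
    change ((μ (TRinv g (TR g η)) - adStar G ξ ν (TRinv g (TR g η))) + ν 0) +
      ((show E × E →L[ℝ] ℝ from ((μ - adStar G ξ ν).comp
        (show E →L[ℝ] E from TRinv g)).comp (ContinuousLinearMap.fst ℝ E E) +
      ν.comp (ContinuousLinearMap.snd ℝ E E)).comp (ContinuousLinearMap.inr ℝ E E))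
        (ad G ξ η) = μ η
    rw [h2, h, map_zero, add_zero]
    exact sub_add_cancel _ _


/-! ### Functional derivatives of a function on `¹T*TG` -/

variable [FiniteDimensional ℝ E]

variable (E) in
/-- The canonical identification `𝔤** ≃ 𝔤` of a finite-dimensional space with its bidual. -/
def bidualToVector : ((E →L[ℝ] ℝ) →L[ℝ] ℝ) →ₗ[ℝ] E where
  toFun Φ := (Module.evalEquiv ℝ E).symm
    (Φ.toLinearMap.comp (LinearMap.toContinuousLinearMap (𝕜 := ℝ) (E := E) (F' := ℝ)).toLinearMap)
  map_add' Φ Ψ := by rw [← map_add]; rfl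
  map_smul' c Φ := by rw [RingHom.id_apply, ← map_smul]; rfl

/-- The defining property of the identification: `⟨l, Φ⟩ = Φ l`. -/
theorem apply_bidualToVector (Φ : (E →L[ℝ] ℝ) →L[ℝ] ℝ) (l : E →L[ℝ] ℝ) :
    l (bidualToVector E Φ) = Φ l := by
  have h := Module.apply_evalEquiv_symm_apply (R := ℝ) (M := E) l.toLinearMap
    (Φ.toLinearMap.comp (LinearMap.toContinuousLinearMap (𝕜 := ℝ) (E := E) (F' := ℝ)).toLinearMap)
  exact h

/-- `δH/δg ∈ T_g^* G`. -/
def deltaG (H : Triv E G → ℝ) (p : Triv E G) : TangentSpace 𝓘(ℝ, E) p.1.1 →L[ℝ] ℝ :=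
  mfderiv 𝓘(ℝ, E) 𝓘(ℝ, ℝ) (fun g : G => H ((g, p.1.2), (p.2.1, p.2.2))) p.1.1

/-- `δH/δξ ∈ 𝔤*`. -/
def deltaXi (H : Triv E G → ℝ) (p : Triv E G) : LieAlgDual G E :=
  fderiv ℝ (fun ξ : LieAlg G E => H ((p.1.1, ξ), (p.2.1, p.2.2))) p.1.2

/-- `δH/δμ ∈ 𝔤** = 𝔤`. -/
def deltaMu (H : Triv E G → ℝ) (p : Triv E G) : LieAlg G E :=
  bidualToVector E (fderiv ℝ (fun μ : LieAlgDual G E => H ((p.1.1, p.1.2), (μ, p.2.2))) p.2.1)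

/-- `δH/δν ∈ 𝔤** = 𝔤`. -/
def deltaNu (H : Triv E G → ℝ) (p : Triv E G) : LieAlg G E :=
  bidualToVector E (fderiv ℝ (fun ν : LieAlgDual G E => H ((p.1.1, p.1.2), (p.2.1, ν))) p.2.2)

/-- `T_e^* R_g (δH/δg) ∈ 𝔤*`. -/
def deltaGRight (H : Triv E G → ℝ) (p : Triv E G) : LieAlgDual G E :=
  (deltaG H p).comp (TR p.1.1)

/-! ### Symplectic structure and Hamiltonian dynamics on `¹T*TG` -/

variable (E G) in
/-- The canonical one-form on `¹T*TG`: the canonical one-form of `T*(G ⋉ 𝔤)` carried over by the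
trivialization. -/
def trivOneForm : OneForm (trivModel E) (Triv E G) := fun p =>
  (canonicalOneForm (tgModel E) (TangentGroup E G) (trivialization.symm p)).comp
    (mfderiv (trivModel E) (ctModel E)
      (trivialization.symm : Triv E G → CotangentBundle (tgModel E) (TangentGroup E G)) p)

variable (E G) in
/-- The symplectic two-form on `¹T*TG`: the canonical symplectic form of `T*(G ⋉ 𝔤)` carried over
by the trivialization. -/
def trivTwoForm : TwoForm (trivModel E) (Triv E G) := fun p =>
  (canonicalTwoForm (tgModel E) (TangentGroup E G)
      (trivialization.symm p)).compContinuousLinearMap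
    (mfderiv (trivModel E) (ctModel E)
      (trivialization.symm : Triv E G → CotangentBundle (tgModel E) (TangentGroup E G)) p)

/-- `X` is the Hamiltonian vector field of `H` on `¹T*TG`: `i_X Ω = -dH`. -/
def IsHamiltonianField (H : Triv E G → ℝ) (X : ∀ p : Triv E G, TangentSpace (trivModel E) p) :
    Prop :=
  ∀ (p : Triv E G) (w : TangentSpace (trivModel E) p),
    trivTwoForm E G p ![X p, w] = -(mfderiv (trivModel E) 𝓘(ℝ, ℝ) H p w : ℝ)

end LieGroupConventions

end TrivializedHamilton

end

open TrivializedHamilton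

noncomputable section

namespace TrivializedHamilton

open Filter Topology Set

/-! The bracket is only known as the derivative of `Ad` at the identity, so its algebra is derived
first. Let `m` be the multiplication read in the chart at the identity. Differentiating `g (g⁻¹ h g)
= h g` in both variables gives `[u, v] = D²m((0,u),(v,0)) - D²m((u,0),(0,v))`, and symmetry of `D²m`
makes this skew (`ad_skew`). Differentiating the equivariance of `Ad` under conjugation, twice,
gives the Jacobi identity (`ad_ad`). The right-invariant fields then follow from the product rule,
with `ad` and `-ad` as the derivatives of `Ad_g` and `Ad_{g⁻¹}` at the identity.

In bundle charts the canonical one-form is `p dq`, so `Ω` has the constant expression `dp ∧ dq`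
(`canonicalTwoForm_apply`). It remains to differentiate the covector part `((μ - ad*_ξ ν) ∘ T_g
R_{g⁻¹}, ν)` of the inverse trivialization. The derivative of `g ↦ T_g R_{g⁻¹}` in a chart is never
computed: `Ω` sees only its antisymmetric part, which the Maurer-Cartan equation
(`mcDeriv_antisymm`) identifies with `-[·,·]`. The remaining terms in `ξ` cancel by Jacobi.

Every tangent vector is the value of some right-invariant field, so `i_X Ω = -dH` may be tested on
those fields alone. With `dH` split into partial derivatives, varying the four slots of the test
generator determines the generator of `X`. Hamilton's equations are the components of the resulting
vector. -/

theorem hasMFDerivAt_comp_of_eq {V₁ V₂ V₃ H₁ H₂ H₃ M₁ M₂ M₃ : Type*}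
    [NormedAddCommGroup V₁] [NormedSpace ℝ V₁] [NormedAddCommGroup V₂] [NormedSpace ℝ V₂]
    [NormedAddCommGroup V₃] [NormedSpace ℝ V₃] [TopologicalSpace H₁] [TopologicalSpace H₂]
    [TopologicalSpace H₃] [TopologicalSpace M₁] [TopologicalSpace M₂] [TopologicalSpace M₃]
    [ChartedSpace H₁ M₁] [ChartedSpace H₂ M₂] [ChartedSpace H₃ M₃]
    {I₁ : ModelWithCorners ℝ V₁ H₁} {I₂ : ModelWithCorners ℝ V₂ H₂}
    {I₃ : ModelWithCorners ℝ V₃ H₃} {u : M₂ → M₃} {f : M₁ → M₂} {x : M₁} {y : M₂}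
    {u' : V₂ →L[ℝ] V₃} {f' : V₁ →L[ℝ] V₂} (hu : HasMFDerivAt I₂ I₃ u y u')
    (hf : HasMFDerivAt I₁ I₂ f x f') (h : f x = y) :
    HasMFDerivAt I₁ I₃ (fun z => u (f z)) x (u'.comp f') := by
  subst h
  exact hu.comp x hf

theorem two_le_infty : (2 : WithTop ℕ∞) ≤ ∞ := WithTop.coe_le_coe.2 (le_top (a := (2 : ℕ∞)))

/-- Differentiating the identity `b (A x u) (A x v) = A x (b u v)` at a point where `A = id`
and `A' = b` yields the Jacobi identity for `b`. -/
theorem jacobi_of_hasFDerivAt {V : Type*} [NormedAddCommGroup V] [NormedSpace ℝ V]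
    {A : V → V →L[ℝ] V} {b : V →L[ℝ] V →L[ℝ] V} {e : V} (hA : HasFDerivAt A b e)
    (he : ∀ v, A e v = v) (u v w : V) (h : ∀ x, b (A x u) (A x v) = A x (b u v)) :
    b w (b u v) = b (b w u) v + b u (b w v) := by
  have hu := hA.clm_apply (hasFDerivAt_const u e)
  have hv := hA.clm_apply (hasFDerivAt_const v e)
  have h1 := (b.hasFDerivAt.comp e hu).clm_apply hv
  have h2 := hA.clm_apply (hasFDerivAt_const (b u v) e)
  have h3 := DFunLike.congr_fun
    (h1.unique (h2.congr_of_eventuallyEq (Eventually.of_forall h))) w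
  simp [he] at h3
  rw [← h3, add_comm]

/-! ### The bracket: skew symmetry, equivariance, Jacobi identity. -/

section LieGroup

variable {E : Type*} [NormedAddCommGroup E] [NormedSpace ℝ E]
  {G : Type*} [TopologicalSpace G] [ChartedSpace E G] [Group G]

variable (E G) in
/-- The group multiplication read in the preferred chart at the identity. -/
def chartMul (z : E × E) : E :=
  extChartAt 𝓘(ℝ, E) (1 : G)
    ((extChartAt 𝓘(ℝ, E) (1 : G)).symm z.1 * (extChartAt 𝓘(ℝ, E) (1 : G)).symm z.2)

variable (E G) in
/-- The coordinates of the identity in the preferred chart at the identity. -/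
def chartOne : E := extChartAt 𝓘(ℝ, E) (1 : G) 1

variable (E G) in
@[simp] theorem extChartAt_symm_chartOne :
    (extChartAt 𝓘(ℝ, E) (1 : G)).symm (chartOne E G) = 1 := extChartAt_to_inv (I := 𝓘(ℝ, E)) 1

theorem Ad_one (v : LieAlg G E) : Ad (1 : G) v = v := by
  have : (fun h : G => (1 : G)⁻¹ * h * 1) = id := by ext; simp
  rw [Ad, this, mfderiv_id]
  rfl

theorem chartMul_chartOne_left {z : E} (hz : z ∈ (extChartAt 𝓘(ℝ, E) (1 : G)).target) :
    chartMul E G (chartOne E G, z) = z := by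
  simp only [chartMul, extChartAt_symm_chartOne, one_mul]
  exact (extChartAt 𝓘(ℝ, E) (1 : G)).right_inv hz

variable [LieGroup 𝓘(ℝ, E) ∞ G]

variable (E) in
-- The tangent space at `x` is the model space seen through the preferred chart at `x`. This is what
-- allows manifold derivatives to be exchanged for ordinary derivatives in coordinates.
theorem hasMFDerivAt_extChartAt_self (x : G) :
    HasMFDerivAt 𝓘(ℝ, E) 𝓘(ℝ, E) (extChartAt 𝓘(ℝ, E) x) x (ContinuousLinearMap.id ℝ E) := by
  have : IsManifold 𝓘(ℝ, E) 1 G := IsManifold.of_le (n := ∞) (by simp)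
  have := (mdifferentiableAt_extChartAt (I := 𝓘(ℝ, E)) (mem_chart_source E x)).hasMFDerivAt
  rwa [mfderiv_extChartAt_self] at this

variable (E) in
theorem mdifferentiableAt_mul_right (a x : G) :
    MDifferentiableAt 𝓘(ℝ, E) 𝓘(ℝ, E) (fun h : G => h * a) x :=
  (contMDiff_mul_right (I := 𝓘(ℝ, E)) (n := ∞) (a := a)).contMDiffAt.mdifferentiableAt (by simp)

theorem contMDiff_conj :
    ContMDiff (𝓘(ℝ, E).prod 𝓘(ℝ, E)) 𝓘(ℝ, E) ∞ (fun p : G × G => p.1⁻¹ * p.2 * p.1) := by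
  have := LieGroup.toContMDiffMul (I := 𝓘(ℝ, E)) (n := ∞) (G := G)
  exact ((contMDiff_fst.inv).mul contMDiff_snd).mul contMDiff_fst

variable (E) in
theorem mdifferentiableAt_conj (g x : G) :
    MDifferentiableAt 𝓘(ℝ, E) 𝓘(ℝ, E) (fun h : G => g⁻¹ * h * g) x :=
  ((contMDiff_conj (E := E)).comp (contMDiff_const.prodMk contMDiff_id)).contMDiffAt
    |>.mdifferentiableAt (by simp)

theorem contMDiffAt_extChartAt_symm_self (x : G) :
    ContMDiffAt 𝓘(ℝ, E) 𝓘(ℝ, E) ∞ (extChartAt 𝓘(ℝ, E) x).symm (extChartAt 𝓘(ℝ, E) x x) :=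
  (contMDiffOn_extChartAt_symm (I := 𝓘(ℝ, E)) (n := ∞) x).contMDiffAt
    (extChartAt_target_mem_nhds (I := 𝓘(ℝ, E)) x)

variable (E) in
theorem hasMFDerivAt_extChartAt_symm_self (x : G) :
    HasMFDerivAt 𝓘(ℝ, E) 𝓘(ℝ, E) (extChartAt 𝓘(ℝ, E) x).symm (extChartAt 𝓘(ℝ, E) x x)
      (ContinuousLinearMap.id ℝ E) := by
  have : IsManifold 𝓘(ℝ, E) 1 G := IsManifold.of_le (n := ∞) (by simp)
  have h := ((contMDiffAt_extChartAt_symm_self (E := E) x).mdifferentiableAt (by simp)).hasMFDerivAt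
  have h2 := mfderivWithin_range_extChartAt_symm (I := 𝓘(ℝ, E)) (x := x)
  rw [modelWithCornersSelf_coe, Set.range_id, mfderivWithin_univ] at h2
  rwa [h2] at h

variable (E G) in
theorem contDiffAt_chartMul : ContDiffAt ℝ ∞ (chartMul E G) (chartOne E G, chartOne E G) := by
  have := LieGroup.toContMDiffMul (I := 𝓘(ℝ, E)) (n := ∞) (G := G)
  have h1 := contMDiffAt_extChartAt_symm_self (E := E) (1 : G)
  have h2 : ContMDiffAt 𝓘(ℝ, E × E) 𝓘(ℝ, E) ∞ (fun z : E × E =>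
      (extChartAt 𝓘(ℝ, E) (1 : G)).symm z.1 * (extChartAt 𝓘(ℝ, E) (1 : G)).symm z.2)
      (chartOne E G, chartOne E G) :=
    (h1.comp (chartOne E G, chartOne E G) contDiff_fst.contMDiff.contMDiffAt).mul
      (h1.comp (chartOne E G, chartOne E G) contDiff_snd.contMDiff.contMDiffAt)
  refine ContMDiffAt.contDiffAt (ContMDiffAt.comp (I' := 𝓘(ℝ, E)) _ ?_ h2)
  simp only [extChartAt_symm_chartOne, mul_one]
  exact contMDiffAt_extChartAt

variable (E) in
-- `Ad` is a partial derivative of the smooth map `(g, h) ↦ g⁻¹ h g`. All conjugations fix the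
-- identity, so the coordinate changes on both sides of `inTangentCoordinates` are trivial.
theorem mdifferentiableAt_Ad : MDifferentiableAt 𝓘(ℝ, E) 𝓘(ℝ, E →L[ℝ] E)
    (fun g : G => (Ad g : LieAlg G E →L[ℝ] LieAlg G E)) 1 := by
  have : IsManifold 𝓘(ℝ, E) 1 G := IsManifold.of_le (n := ∞) (by simp)
  have h := ContMDiffAt.mfderiv (I := 𝓘(ℝ, E)) (I' := 𝓘(ℝ, E)) (J := 𝓘(ℝ, E)) (x₀ := (1 : G))
    (fun g h : G => g⁻¹ * h * g) (fun _ => 1) (m := 1) (n := ∞)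
    (contMDiff_conj (E := E)).contMDiffAt contMDiffAt_const
    (by rw [one_add_one_eq_two]; exact two_le_infty)
  refine (h.mdifferentiableAt one_ne_zero).congr_of_eventuallyEq
    (Eventually.of_forall fun g => ?_)
  refine Eq.trans ?_ (inTangentCoordinates_eq (I := 𝓘(ℝ, E)) (I' := 𝓘(ℝ, E))
    (fun _ : G => (1 : G)) (fun x : G => x⁻¹ * 1 * x) (fun x => Ad x)
    (mem_chart_source _ _) (by simp)).symm
  refine ContinuousLinearMap.ext fun v => ?_
  simp only [inv_one, mul_one, inv_mul_cancel]
  exact ((tangentCoordChange_self (I := 𝓘(ℝ, E)) (mem_extChartAt_source (1 : G))).trans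
    (congrArg (Ad g) (tangentCoordChange_self (I := 𝓘(ℝ, E)) (mem_extChartAt_source (1 : G))))).symm

/-- `Ad_g` is the derivative of conjugation read in the chart at the identity. -/
theorem hasFDerivAt_chart_conj (g : G) :
    HasFDerivAt (fun z => extChartAt 𝓘(ℝ, E) (1 : G)
      (g⁻¹ * (extChartAt 𝓘(ℝ, E) (1 : G)).symm z * g)) (Ad g : E →L[ℝ] E) (chartOne E G) := by
  have h1 := hasMFDerivAt_extChartAt_symm_self E (1 : G)
  have h2 := (mdifferentiableAt_conj E g 1).hasMFDerivAt
  have h3 := hasMFDerivAt_extChartAt_self E (1 : G)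
  have h4 := hasMFDerivAt_comp_of_eq h2 h1 (extChartAt_symm_chartOne E G)
  have h5 := hasMFDerivAt_comp_of_eq h3 h4 (by simp)
  exact h5.hasFDerivAt

variable (E G) in
theorem eventually_contDiffAt_chartMul :
    ∀ᶠ z in 𝓝 (chartOne E G, chartOne E G), ContDiffAt ℝ 2 (chartMul E G) z :=
  ((contDiffAt_chartMul E G).of_le two_le_infty).eventually (by simp)

theorem fderiv_chartMul_inr (v : E) :
    fderiv ℝ (chartMul E G) (chartOne E G, chartOne E G) (0, v) = v := by
  have h1 : HasFDerivAt (fun z : E => chartMul E G (chartOne E G, z))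
      (ContinuousLinearMap.id ℝ E) (chartOne E G) :=
    (hasFDerivAt_id _).congr_of_eventuallyEq <| by
      filter_upwards [extChartAt_target_mem_nhds (I := 𝓘(ℝ, E)) (1 : G)] with z hz
      exact chartMul_chartOne_left hz
  have h2 := (((contDiffAt_chartMul E G).differentiableAt (by simp)).hasFDerivAt).comp
    (chartOne E G) (hasFDerivAt_prodMk_right (𝕜 := ℝ) (chartOne E G) (chartOne E G))
  exact DFunLike.congr_fun (h2.unique h1) v

/-- The identity `g (g⁻¹ h g) = h g`, differentiated in `h` at the identity. -/
theorem eventually_fderiv_chartMul_Ad (v : E) : ∀ᶠ x in 𝓝 (chartOne E G),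
    fderiv ℝ (chartMul E G) (x, chartOne E G)
        (0, Ad ((extChartAt 𝓘(ℝ, E) (1 : G)).symm x) v) =
      fderiv ℝ (chartMul E G) (chartOne E G, x) (v, 0) := by
  have c1 : Tendsto (fun x => (x, chartOne E G)) (𝓝 (chartOne E G))
      (𝓝 (chartOne E G, chartOne E G)) := (Continuous.prodMk_left _).tendsto _
  have c2 : Tendsto (fun x => (chartOne E G, x)) (𝓝 (chartOne E G))
      (𝓝 (chartOne E G, chartOne E G)) := (Continuous.prodMk_right _).tendsto _
  filter_upwards [c1.eventually (eventually_contDiffAt_chartMul E G),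
    c2.eventually (eventually_contDiffAt_chartMul E G)] with x hx1 hx2
  set g := (extChartAt 𝓘(ℝ, E) (1 : G)).symm x with hg
  have hc := hasFDerivAt_chart_conj (E := E) g
  have e : extChartAt 𝓘(ℝ, E) (1 : G) (g⁻¹ * (extChartAt 𝓘(ℝ, E) (1 : G)).symm (chartOne E G) * g)
      = chartOne E G := by simp [chartOne]
  have d1 := (hx1.differentiableAt (by simp)).hasFDerivAt
  rw [← e] at d1
  have d1' := d1.comp (chartOne E G) ((hasFDerivAt_const x (chartOne E G)).prodMk hc)
  have d2 := (hx2.differentiableAt (by simp)).hasFDerivAt.comp (chartOne E G)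
    (hasFDerivAt_prodMk_left (𝕜 := ℝ) (chartOne E G) x)
  -- The chart cancels its inverse only while the conjugate stays in the chart domain, which holds
  -- near the identity because conjugation fixes it.
  have hs : ∀ᶠ z in 𝓝 (chartOne E G), g⁻¹ * (extChartAt 𝓘(ℝ, E) (1 : G)).symm z * g ∈
      (extChartAt 𝓘(ℝ, E) (1 : G)).source := by
    have t1 : ContinuousAt (fun z => g⁻¹ * (extChartAt 𝓘(ℝ, E) (1 : G)).symm z * g)
        (chartOne E G) :=
      ContinuousAt.comp_of_eq (mdifferentiableAt_conj E g 1).continuousAt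
        (contMDiffAt_extChartAt_symm_self (E := E) (1 : G)).continuousAt
        (extChartAt_symm_chartOne E G)
    refine t1.eventually_mem ?_
    rw [extChartAt_symm_chartOne, mul_one, inv_mul_cancel]
    exact extChartAt_source_mem_nhds (I := 𝓘(ℝ, E)) (1 : G)
  have d3 := d2.unique (d1'.congr_of_eventuallyEq ?_)
  · have := DFunLike.congr_fun d3 v
    rw [e] at this
    simpa using this.symm
  · filter_upwards [hs] with z hz
    simp only [Function.comp_apply, chartMul]
    rw [(extChartAt 𝓘(ℝ, E) (1 : G)).left_inv hz, ← hg]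
    group

variable (E G) in
theorem hasFDerivAt_Ad_chart : HasFDerivAt
    (fun x => (Ad ((extChartAt 𝓘(ℝ, E) (1 : G)).symm x) : E →L[ℝ] E)) (ad G : E →L[ℝ] E →L[ℝ] E)
    (chartOne E G) :=
  (hasMFDerivAt_comp_of_eq (mdifferentiableAt_Ad (G := G) E).hasMFDerivAt
    (hasMFDerivAt_extChartAt_symm_self E (1 : G)) (extChartAt_symm_chartOne E G)).hasFDerivAt

/-- The bracket is the antisymmetric part of the second derivative of the multiplication. -/
theorem ad_eq_fderiv_fderiv (u v : LieAlg G E) : ad G u v =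
    fderiv ℝ (fderiv ℝ (chartMul E G)) (chartOne E G, chartOne E G) (0, u) (v, 0) -
      fderiv ℝ (fderiv ℝ (chartMul E G)) (chartOne E G, chartOne E G) (u, 0) (0, v) := by
  have hD := ((((contDiffAt_chartMul E G).of_le two_le_infty).fderiv_right (m := 1)
    one_add_one_eq_two.le).differentiableAt one_ne_zero).hasFDerivAt
  -- Differentiating the left side of `eventually_fderiv_chartMul_Ad` produces a second derivative
  -- of the multiplication plus `Dm(0, [u, v])`, and the latter is `[u, v]` itself.
  have h1 := (hD.comp (f := fun x => (x, chartOne E G)) (chartOne E G)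
    (hasFDerivAt_prodMk_left (𝕜 := ℝ) (chartOne E G)
    (chartOne E G))).clm_apply ((hasFDerivAt_const (0 : E) (chartOne E G)).prodMk
      ((hasFDerivAt_Ad_chart E G).clm_apply (hasFDerivAt_const (v : E) (chartOne E G))))
  have h2 := (hD.comp (chartOne E G) (hasFDerivAt_prodMk_right (𝕜 := ℝ) (chartOne E G)
    (chartOne E G))).clm_apply (hasFDerivAt_const ((v, 0) : E × E) (chartOne E G))
  have h3 := DFunLike.congr_fun
    (h2.unique (h1.congr_of_eventuallyEq
      ((eventually_fderiv_chartMul_Ad (E := E) (G := G) v).mono fun x hx => hx.symm))) u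
  simp [-extChartAt, fderiv_chartMul_inr] at h3
  rw [Ad_one] at h3
  exact eq_sub_of_add_eq h3.symm

theorem ad_skew (u v : LieAlg G E) : ad G u v = -ad G v u := by
  have h : IsSymmSndFDerivAt ℝ (chartMul E G) (chartOne E G, chartOne E G) :=
    (contDiffAt_chartMul E G).isSymmSndFDerivAt (by simpa using two_le_infty)
  rw [ad_eq_fderiv_fderiv, ad_eq_fderiv_fderiv, h.eq (0, u), h.eq (u, 0), neg_sub]

/-- Conjugations satisfy `I_{g⁻¹hg} ∘ I_g = I_g ∘ I_h`; this is its derivative at the identity. -/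
theorem Ad_conj_Ad (g h : G) (v : LieAlg G E) : Ad (g⁻¹ * h * g) (Ad g v) = Ad g (Ad h v) := by
  have e : (fun k : G => (g⁻¹ * h * g)⁻¹ * (g⁻¹ * k * g) * (g⁻¹ * h * g)) =
    fun k => g⁻¹ * (h⁻¹ * k * h) * g := by ext; group
  have h1 := hasMFDerivAt_comp_of_eq (mdifferentiableAt_conj E g 1).hasMFDerivAt
    (mdifferentiableAt_conj E h 1).hasMFDerivAt (by simp)
  have h2 := hasMFDerivAt_comp_of_eq (mdifferentiableAt_conj E (g⁻¹ * h * g) 1).hasMFDerivAt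
    (mdifferentiableAt_conj E g 1).hasMFDerivAt (by simp)
  rw [e] at h2
  exact DFunLike.congr_fun (h2.mfderiv.symm.trans h1.mfderiv) v

/-- The derivative of `Ad_conj_Ad` in `h` at the identity, in the direction `u`. -/
theorem ad_Ad (g : G) (u v : LieAlg G E) : ad G (Ad g u) (Ad g v) = Ad g (ad G u v) := by
  have hA := (mdifferentiableAt_Ad (G := G) E).hasMFDerivAt
  have hev : ∀ w : E, ∀ B : E →L[ℝ] E, HasMFDerivAt 𝓘(ℝ, E →L[ℝ] E) 𝓘(ℝ, E)
      (fun B => B w) B (ContinuousLinearMap.apply ℝ E w) := fun w B =>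
    (ContinuousLinearMap.apply ℝ E w).hasFDerivAt.hasMFDerivAt
  have h1 := hasMFDerivAt_comp_of_eq (hev (Ad g v) _) (hasMFDerivAt_comp_of_eq hA
    (mdifferentiableAt_conj E g 1).hasMFDerivAt (by simp)) rfl
  have h2 := hasMFDerivAt_comp_of_eq (Ad g : E →L[ℝ] E).hasFDerivAt.hasMFDerivAt
    (hasMFDerivAt_comp_of_eq (hev v _) hA rfl) rfl
  have h3 := h2.congr_of_eventuallyEq (f₁ := fun h : G => Ad (g⁻¹ * h * g) (Ad g v))
    (Eventually.of_forall fun h => Ad_conj_Ad g h v)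
  exact DFunLike.congr_fun (hasMFDerivAt_unique h1 h3) u

/-- The Jacobi identity. -/
theorem ad_ad (w u v : LieAlg G E) :
    ad G w (ad G u v) = ad G (ad G w u) v + ad G u (ad G w v) := by
  refine jacobi_of_hasFDerivAt (hasFDerivAt_Ad_chart E G) (fun v => ?_) u v w
    fun x => ad_Ad _ u v
  rw [extChartAt_symm_chartOne]
  exact Ad_one v

end LieGroup

/-! ### Right-invariant vector fields on the trivialized space. -/

theorem hasMFDerivAt_prodMk_space {V₁ V₂ V₃ H₁ M : Type*}
    [NormedAddCommGroup V₁] [NormedSpace ℝ V₁] [NormedAddCommGroup V₂] [NormedSpace ℝ V₂]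
    [NormedAddCommGroup V₃] [NormedSpace ℝ V₃] [TopologicalSpace H₁] [TopologicalSpace M]
    [ChartedSpace H₁ M] {I : ModelWithCorners ℝ V₁ H₁} {f : M → V₂} {g : M → V₃} {x : M}
    {f' : V₁ →L[ℝ] V₂} {g' : V₁ →L[ℝ] V₃} (hf : HasMFDerivAt I 𝓘(ℝ, V₂) f x f')
    (hg : HasMFDerivAt I 𝓘(ℝ, V₃) g x g') :
    HasMFDerivAt I 𝓘(ℝ, V₂ × V₃) (fun z => (f z, g z)) x (f'.prod g') :=
  ⟨hf.1.prodMk hg.1, hf.2.prodMk hg.2⟩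

/-- The product rule for `A x (C x v) = v` gives `b + c = 0`. Applied to `Ad_g` and `Ad_{g⁻¹}`, it
makes the derivative of group inversion unnecessary. -/
theorem neg_of_hasFDerivAt_inverse {V : Type*} [NormedAddCommGroup V] [NormedSpace ℝ V]
    {A C : V → V →L[ℝ] V} {b c : V →L[ℝ] V →L[ℝ] V} {e : V} (hA : HasFDerivAt A b e)
    (hC : HasFDerivAt C c e) (hAe : A e = 1) (hCe : C e = 1) (h : ∀ x v, A x (C x v) = v) :
    c = -b := by
  ext u v
  have h1 := hA.clm_apply (hC.clm_apply (hasFDerivAt_const v e))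
  have h2 := DFunLike.congr_fun (h1.unique ((hasFDerivAt_const v e).congr_of_eventuallyEq
    (Eventually.of_forall fun x => h x v))) u
  simp [hAe, hCe] at h2
  exact eq_neg_of_add_eq_zero_left h2

section LieGroup

variable {E : Type*} [NormedAddCommGroup E] [NormedSpace ℝ E]
  {G : Type*} [TopologicalSpace G] [ChartedSpace E G]

/-- The covector part of the multiplication of `¹T*TG`, as a function of `Ad_g` and `ξ`. -/
theorem hasFDerivAt_covector_part (b : E →L[ℝ] E →L[ℝ] E) (μ ν : E →L[ℝ] ℝ) :
    HasFDerivAt (fun z : (E →L[ℝ] E) × E => (μ + ν.comp (b (z.1 z.2))).comp z.1)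
      ((ContinuousLinearMap.compL ℝ E E ℝ μ).comp (ContinuousLinearMap.fst ℝ _ _) +
        ((ContinuousLinearMap.compL ℝ E E ℝ ν).comp b).comp (ContinuousLinearMap.snd ℝ _ _))
      (1, 0) := by
  have h1 := (hasFDerivAt_fst (𝕜 := ℝ) (p := ((1 : E →L[ℝ] E), (0 : E)))).clm_apply
    (hasFDerivAt_snd (𝕜 := ℝ) (p := ((1 : E →L[ℝ] E), (0 : E))))
  have h2 := ((((ContinuousLinearMap.compL ℝ E E ℝ ν).comp b).hasFDerivAt.comp _ h1).const_add
    μ).clm_comp (hasFDerivAt_fst (𝕜 := ℝ) (p := ((1 : E →L[ℝ] E), (0 : E))))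
  refine h2.congr_fderiv ?_
  refine ContinuousLinearMap.ext fun z => ContinuousLinearMap.ext fun y => ?_
  simp [-map_one]

variable (E G) in
/-- Coordinate projections of `¹T*TG` and their derivatives. -/
theorem hasMFDerivAt_triv_proj (p : Triv E G) :
    HasMFDerivAt (trivModel E) 𝓘(ℝ, E) (fun q : Triv E G => q.1.1) p
        ((ContinuousLinearMap.fst ℝ E E).comp
          (ContinuousLinearMap.fst ℝ (E × E) ((E →L[ℝ] ℝ) × (E →L[ℝ] ℝ)))) ∧
      HasMFDerivAt (trivModel E) 𝓘(ℝ, E) (fun q : Triv E G => q.1.2) p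
        ((ContinuousLinearMap.snd ℝ E E).comp
          (ContinuousLinearMap.fst ℝ (E × E) ((E →L[ℝ] ℝ) × (E →L[ℝ] ℝ)))) ∧
      HasMFDerivAt (trivModel E) 𝓘(ℝ, E →L[ℝ] ℝ) (fun q : Triv E G => q.2.1) p
        ((ContinuousLinearMap.fst ℝ (E →L[ℝ] ℝ) (E →L[ℝ] ℝ)).comp
          (ContinuousLinearMap.snd ℝ (E × E) ((E →L[ℝ] ℝ) × (E →L[ℝ] ℝ)))) ∧
      HasMFDerivAt (trivModel E) 𝓘(ℝ, E →L[ℝ] ℝ) (fun q : Triv E G => q.2.2) p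
        ((ContinuousLinearMap.snd ℝ (E →L[ℝ] ℝ) (E →L[ℝ] ℝ)).comp
          (ContinuousLinearMap.snd ℝ (E × E) ((E →L[ℝ] ℝ) × (E →L[ℝ] ℝ)))) :=
  ⟨hasMFDerivAt_comp_of_eq (hasMFDerivAt_fst p.1) (hasMFDerivAt_fst p) rfl,
    hasMFDerivAt_comp_of_eq (hasMFDerivAt_snd p.1) (hasMFDerivAt_fst p) rfl,
    hasMFDerivAt_comp_of_eq (hasMFDerivAt_fst p.2) (hasMFDerivAt_snd p) rfl,
    hasMFDerivAt_comp_of_eq (hasMFDerivAt_snd p.2) (hasMFDerivAt_snd p) rfl⟩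

variable (E) in
theorem eventually_mem_chart_source (p : Triv E G) :
    ∀ᶠ q in 𝓝 p, q.1.1 ∈ (extChartAt 𝓘(ℝ, E) p.1.1).source :=
  (continuous_fst.comp continuous_fst).continuousAt.eventually_mem
    (extChartAt_source_mem_nhds (I := 𝓘(ℝ, E)) p.1.1)

variable [Group G]

variable (E G) in
theorem Ad_one_eq : (Ad (1 : G) : E →L[ℝ] E) = 1 := ContinuousLinearMap.ext fun v => Ad_one v

variable [LieGroup 𝓘(ℝ, E) ∞ G]

theorem Ad_Ad_inv (g : G) (v : LieAlg G E) : Ad g (Ad g⁻¹ v) = v := by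
  have e : (fun k : G => g⁻¹ * (g⁻¹⁻¹ * k * g⁻¹) * g) = id := by ext; simp [mul_assoc]
  have h1 := hasMFDerivAt_comp_of_eq (mdifferentiableAt_conj E g 1).hasMFDerivAt
    (mdifferentiableAt_conj E g⁻¹ 1).hasMFDerivAt (by simp)
  rw [e] at h1
  exact DFunLike.congr_fun (h1.mfderiv.symm.trans mfderiv_id) v

variable (E G) in
theorem hasMFDerivAt_Ad : HasMFDerivAt 𝓘(ℝ, E) 𝓘(ℝ, E →L[ℝ] E) (fun g : G => (Ad g : E →L[ℝ] E)) 1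
    (ad G : E →L[ℝ] E →L[ℝ] E) :=
  (mdifferentiableAt_Ad (G := G) E).hasMFDerivAt

variable (E G) in
theorem hasMFDerivAt_Ad_inv : HasMFDerivAt 𝓘(ℝ, E) 𝓘(ℝ, E →L[ℝ] E)
    (fun g : G => (Ad g⁻¹ : E →L[ℝ] E)) 1 (-(ad G : E →L[ℝ] E →L[ℝ] E)) := by
  have hi : MDifferentiableAt 𝓘(ℝ, E) 𝓘(ℝ, E) (fun g : G => g⁻¹) 1 :=
    (contMDiff_inv 𝓘(ℝ, E) ∞ (G := G)).contMDiffAt.mdifferentiableAt (by simp)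
  have h1 := hasMFDerivAt_comp_of_eq (hasMFDerivAt_Ad E G) hi.hasMFDerivAt inv_one
  have h2 := hasMFDerivAt_comp_of_eq h1 (hasMFDerivAt_extChartAt_symm_self E (1 : G))
    (extChartAt_symm_chartOne E G)
  have h3 := neg_of_hasFDerivAt_inverse (hasFDerivAt_Ad_chart E G) h2.hasFDerivAt
    ?_ ?_ fun x v => Ad_Ad_inv _ v
  · rw [← h3]
    exact h1
  · exact (congrArg Ad (extChartAt_symm_chartOne E G)).trans (Ad_one_eq E G)
  · refine (congrArg (fun g : G => (Ad g⁻¹ : E →L[ℝ] E)) (extChartAt_symm_chartOne E G)).trans ?_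
    simp only [inv_one]
    exact Ad_one_eq E G

theorem rightInvariantField_apply (η ζ : LieAlg G E) (l₁ l₂ : LieAlgDual G E)
    (g : G) (ξ : LieAlg G E) (μ ν : LieAlgDual G E) :
    rightInvariantField η ζ l₁ l₂ ((g, ξ), (μ, ν)) =
      ((TR g η, ζ + ad G ξ η),
        (l₁ + adStar G η μ + adStar G ζ ν, l₂ + adStar G η ν)) := by
  obtain ⟨p1, p2, p3, p4⟩ := hasMFDerivAt_triv_proj E G (trivOne E G)
  have a1 := hasMFDerivAt_comp_of_eq (hasMFDerivAt_Ad E G) p1 rfl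
  have a2 := hasMFDerivAt_comp_of_eq (hasMFDerivAt_Ad_inv E G) p1 rfl
  have q1 := hasMFDerivAt_comp_of_eq (mdifferentiableAt_mul_right E g 1).hasMFDerivAt p1 rfl
  have q2 := p2.add (hasMFDerivAt_comp_of_eq
    (ContinuousLinearMap.apply ℝ E (ξ : E)).hasFDerivAt.hasMFDerivAt a2 rfl)
  have q3 := p3.add (hasMFDerivAt_comp_of_eq
    (hasFDerivAt_covector_part (ad G) μ ν).hasMFDerivAt
    (hasMFDerivAt_prodMk_space a1 p2) (Prod.ext (Ad_one_eq E G) rfl))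
  have q4 := p4.add (hasMFDerivAt_comp_of_eq
    (ContinuousLinearMap.compL ℝ E E ℝ ν).hasFDerivAt.hasMFDerivAt a1 rfl)
  have q := (q1.prodMk q2).prodMk (q3.prodMk q4)
  have e := DFunLike.congr_fun (q.congr_of_eventuallyEq
    (f₁ := fun q : Triv E G => trivMul q ((g, ξ), (μ, ν)))
    (Eventually.of_forall fun q => ?_)).mfderiv
    (((η, ζ), (l₁, l₂)) : (E × E) × ((E →L[ℝ] ℝ) × (E →L[ℝ] ℝ)))
  · refine e.trans ?_
    refine Prod.ext (Prod.ext rfl ?_) (Prod.ext ?_ rfl)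
    -- Differentiating `Ad_{g⁻¹} ξ` along `η` gives `-[η, ξ]`.
    · exact congrArg (ζ + ·) (ad_skew ξ η).symm
    · exact (add_assoc _ _ _).symm
  · simp only [trivMul, AdStar, inv_inv]
    rfl

end LieGroup

/-! ### Canonical forms of a cotangent bundle in bundle charts. -/

section Cotangent

variable {V : Type*} [NormedAddCommGroup V] [NormedSpace ℝ V]
  {H : Type*} [TopologicalSpace H] {I : ModelWithCorners ℝ V H}
  {M : Type*} [TopologicalSpace M] [ChartedSpace H M]

/-- The exterior derivative of a one-form with linear coefficients. -/
theorem extDeriv_ofSubsingleton (B : V →L[ℝ] V →L[ℝ] ℝ) (y w₁ w₂ : V) :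
    extDeriv (fun z : V => ContinuousAlternatingMap.ofSubsingleton ℝ V ℝ (0 : Fin 1) (B z)) y
      ![w₁, w₂] = B w₁ w₂ - B w₂ w₁ := by
  have h := ((ContinuousAlternatingMap.ofSubsingletonLIE (𝕜 := ℝ) (E := V) (F := ℝ)
    (0 : Fin 1)).toContinuousLinearEquiv.toContinuousLinearMap.comp B).hasFDerivAt (x := y)
  have h2 : HasFDerivAt (fun z : V => ContinuousAlternatingMap.ofSubsingleton ℝ V ℝ (0 : Fin 1)
    (B z)) _ y := h
  rw [extDeriv, h2.fderiv, ContinuousAlternatingMap.alternatizeUncurryFin_apply]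
  simp [Fin.sum_univ_two, Fin.removeNth, sub_eq_add_neg]

/-- The exterior derivative of the tautological form `p dq` on `V × V*`. -/
theorem extDeriv_tautological (y : V × (V →L[ℝ] ℝ)) (w₁ w₂ : V × (V →L[ℝ] ℝ)) :
    extDeriv (fun z : V × (V →L[ℝ] ℝ) => ContinuousAlternatingMap.ofSubsingleton ℝ
      (V × (V →L[ℝ] ℝ)) ℝ (0 : Fin 1) (z.2.comp (ContinuousLinearMap.fst ℝ V (V →L[ℝ] ℝ)))) y
      ![w₁, w₂] = w₁.2 w₂.1 - w₂.2 w₁.1 := by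
  exact extDeriv_ofSubsingleton (((ContinuousLinearMap.compL ℝ (V × (V →L[ℝ] ℝ)) V ℝ).flip
    (ContinuousLinearMap.fst ℝ V (V →L[ℝ] ℝ))).comp (ContinuousLinearMap.snd ℝ V (V →L[ℝ] ℝ)))
    y w₁ w₂

variable [IsManifold I 1 M]

theorem mem_extChartAt_target_fst (α : CotangentBundle I M) {y : V × (V →L[ℝ] ℝ)}
    (hy : y ∈ (extChartAt (I.prod 𝓘(ℝ, V →L[ℝ] ℝ)) α).target) :
    y.1 ∈ (extChartAt I α.proj).target := by
  rw [FiberBundle.extChartAt_target] at hy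
  exact hy.1.1

theorem extChartAt_cotangent_symm_proj (α : CotangentBundle I M) {y : V × (V →L[ℝ] ℝ)}
    (hy : y ∈ (extChartAt (I.prod 𝓘(ℝ, V →L[ℝ] ℝ)) α).target) :
    ((extChartAt (I.prod 𝓘(ℝ, V →L[ℝ] ℝ)) α).symm y).proj = (extChartAt I α.proj).symm y.1 := by
  rw [FiberBundle.extChartAt_target] at hy
  rw [FiberBundle.extChartAt]
  exact (trivializationAt (V →L[ℝ] ℝ) (fun x : M => TangentSpace I x →L[ℝ] Trivial M ℝ x)
    α.proj).proj_symm_apply (by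
      rw [Trivialization.mem_target]
      exact hy.1.2)

/-- Bundle charts lie over base charts, so in the chart at `α` the projection is the first
coordinate. -/
theorem hasMFDerivAt_cotangent_proj (α : CotangentBundle I M) :
    HasMFDerivAt (I.prod 𝓘(ℝ, V →L[ℝ] ℝ)) I (fun β : CotangentBundle I M => β.proj) α
      (ContinuousLinearMap.fst ℝ V (V →L[ℝ] ℝ)) := by
  refine ⟨(FiberBundle.continuous_proj _ _).continuousAt, ?_⟩
  have hev : ∀ y ∈ (extChartAt (I.prod 𝓘(ℝ, V →L[ℝ] ℝ)) α).target,
      writtenInExtChartAt (I.prod 𝓘(ℝ, V →L[ℝ] ℝ)) I α (fun β : CotangentBundle I M => β.proj) y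
        = y.1 := by
    intro y hy
    simp only [writtenInExtChartAt, Function.comp_apply]
    rw [extChartAt_cotangent_symm_proj α hy]
    exact (extChartAt I α.proj).right_inv (mem_extChartAt_target_fst α hy)
  refine HasFDerivWithinAt.congr_of_eventuallyEq (f := Prod.fst)
    (hasFDerivWithinAt_fst (𝕜 := ℝ)) ?_ (hev _ (mem_extChartAt_target _))
  filter_upwards [extChartAt_target_mem_nhdsWithin (I := I.prod 𝓘(ℝ, V →L[ℝ] ℝ)) α] with y hy
  exact hev y hy

theorem canonicalOneForm_eq (α : CotangentBundle I M) :
    canonicalOneForm I M α =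
      (show V →L[ℝ] ℝ from α.snd).comp (ContinuousLinearMap.fst ℝ V (V →L[ℝ] ℝ)) := by
  rw [canonicalOneForm, (hasMFDerivAt_cotangent_proj α).mfderiv]
  rfl

theorem canonicalOneForm_apply (α : CotangentBundle I M) (w : V × (V →L[ℝ] ℝ)) :
    canonicalOneForm I M α w = (show V →L[ℝ] ℝ from α.snd) w.1 := by
  rw [canonicalOneForm_eq]
  rfl

/-- The bundle of linear forms is trivialized by precomposition with the inverse tangent
trivialization, which is the derivative of the inverse base chart. The trivial line bundle
contributes nothing. -/
theorem extChartAt_cotangent [I.Boundaryless] (α β : CotangentBundle I M)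
    (h : β.proj ∈ (chartAt H α.proj).source) :
    extChartAt (I.prod 𝓘(ℝ, V →L[ℝ] ℝ)) α β = (extChartAt I α.proj β.proj,
      (show V →L[ℝ] ℝ from β.snd).comp (show V →L[ℝ] V from
        mfderiv 𝓘(ℝ, V) I (extChartAt I α.proj).symm (extChartAt I α.proj β.proj))) := by
  have e : (trivializationAt V (TangentSpace I) α.proj).symmL ℝ β.proj =
      mfderiv 𝓘(ℝ, V) I (extChartAt I α.proj).symm (extChartAt I α.proj β.proj) := by
    rw [TangentBundle.symmL_trivializationAt h, I.range_eq_univ, mfderivWithin_univ]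
  refine Prod.ext rfl ?_
  rw [← e]
  change (ContinuousLinearMap.inCoordinates V (TangentSpace I) ℝ (Trivial M ℝ) α.proj β.proj
    α.proj β.proj β.snd) = _
  ext v
  simp [ContinuousLinearMap.inCoordinates]
  rfl

theorem isManifold_cotangentBundle [IsManifold I ∞ M] :
    IsManifold (I.prod 𝓘(ℝ, V →L[ℝ] ℝ)) 1 (CotangentBundle I M) := by
  have : IsManifold I (1 + 1) M := IsManifold.of_le (n := ∞)
    (by rw [one_add_one_eq_two]; exact two_le_infty)
  exact Bundle.TotalSpace.isManifold (V →L[ℝ] ℝ)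
    (fun x : M => TangentSpace I x →L[ℝ] Trivial M ℝ x)

theorem extChartAt_cotangent_symm_snd [I.Boundaryless] (α : CotangentBundle I M)
    {y : V × (V →L[ℝ] ℝ)} (hy : y ∈ (extChartAt (I.prod 𝓘(ℝ, V →L[ℝ] ℝ)) α).target) :
    y.2 = (show V →L[ℝ] ℝ from ((extChartAt (I.prod 𝓘(ℝ, V →L[ℝ] ℝ)) α).symm y).snd).comp
      (show V →L[ℝ] V from mfderiv 𝓘(ℝ, V) I (extChartAt I α.proj).symm y.1) := by
  have h1 := extChartAt_cotangent_symm_proj α hy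
  have h2 := (extChartAt I α.proj).map_target (mem_extChartAt_target_fst α hy)
  rw [← h1, extChartAt_source] at h2
  have h3 := extChartAt_cotangent α _ h2
  rw [(extChartAt (I.prod 𝓘(ℝ, V →L[ℝ] ℝ)) α).right_inv hy] at h3
  have h10 : (extChartAt I α.proj) ((extChartAt (I.prod 𝓘(ℝ, V →L[ℝ] ℝ)) α).symm y).proj
    = y.1 := congrArg Prod.fst h3.symm
  have h9 := congrArg Prod.snd h3
  rw [h10] at h9
  exact h9

/-- The derivative of the identity `extChartAt_cotangent_symm_proj`, which holds on the whole open
chart target. -/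
theorem mfderiv_extChartAt_cotangent_symm_fst [I.Boundaryless] [IsManifold I ∞ M]
    (α : CotangentBundle I M) {y : V × (V →L[ℝ] ℝ)}
    (hy : y ∈ (extChartAt (I.prod 𝓘(ℝ, V →L[ℝ] ℝ)) α).target) :
    (ContinuousLinearMap.fst ℝ V (V →L[ℝ] ℝ)).comp
      (show V × (V →L[ℝ] ℝ) →L[ℝ] V × (V →L[ℝ] ℝ) from
        mfderiv 𝓘(ℝ, V × (V →L[ℝ] ℝ)) (I.prod 𝓘(ℝ, V →L[ℝ] ℝ))
          (extChartAt (I.prod 𝓘(ℝ, V →L[ℝ] ℝ)) α).symm y) =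
      (show V →L[ℝ] V from mfderiv 𝓘(ℝ, V) I (extChartAt I α.proj).symm y.1).comp
        (ContinuousLinearMap.fst ℝ V (V →L[ℝ] ℝ)) := by
  have := isManifold_cotangentBundle (I := I) (M := M)
  have h4 := (mdifferentiableWithinAt_extChartAt_symm hy).mdifferentiableAt
    (by rw [(I.prod 𝓘(ℝ, V →L[ℝ] ℝ)).range_eq_univ]; exact univ_mem)
  have h5 := (hasMFDerivAt_cotangent_proj _).comp y h4.hasMFDerivAt
  have h6 := (mdifferentiableWithinAt_extChartAt_symm
    (mem_extChartAt_target_fst α hy)).mdifferentiableAt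
    (by rw [I.range_eq_univ]; exact univ_mem)
  have h7 := hasMFDerivAt_comp_of_eq h6.hasMFDerivAt
    (hasFDerivAt_fst (𝕜 := ℝ) (p := y)).hasMFDerivAt rfl
  exact hasMFDerivAt_unique h5 (h7.congr_of_eventuallyEq (by
    filter_upwards [extChartAt_target_mem_nhds' hy] with z hz
    exact extChartAt_cotangent_symm_proj α hz))

/-- The derivative of the inverse base chart that arises from `Tπ` is the one already absorbed in
the covector coordinate, so the form is `p dq` throughout the chart. -/
theorem inChart_canonicalOneForm [I.Boundaryless] [IsManifold I ∞ M]
    (α : CotangentBundle I M) {y : V × (V →L[ℝ] ℝ)}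
    (hy : y ∈ (extChartAt (I.prod 𝓘(ℝ, V →L[ℝ] ℝ)) α).target) :
    inChart (canonicalOneForm I M) α y = ContinuousAlternatingMap.ofSubsingleton ℝ
        (V × (V →L[ℝ] ℝ)) ℝ (0 : Fin 1) (y.2.comp (ContinuousLinearMap.fst ℝ V (V →L[ℝ] ℝ))) := by
  have h := canonicalOneForm_eq ((extChartAt (I.prod 𝓘(ℝ, V →L[ℝ] ℝ)) α).symm y)
  rw [extChartAt_cotangent_symm_snd α hy, ContinuousLinearMap.comp_assoc,
    ← mfderiv_extChartAt_cotangent_symm_fst α hy, ← ContinuousLinearMap.comp_assoc, inChart, h]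
  rfl

/-- `inChart` agrees with `p dq` near the centre, and the chart has identity derivative there, so
transporting `dp ∧ dq` back changes nothing. -/
theorem canonicalTwoForm_apply [I.Boundaryless] [IsManifold I ∞ M] (α : CotangentBundle I M)
    (w₁ w₂ : V × (V →L[ℝ] ℝ)) :
    canonicalTwoForm I M α ![w₁, w₂] = w₁.2 w₂.1 - w₂.2 w₁.1 := by
  have := isManifold_cotangentBundle (I := I) (M := M)
  have hev : inChart (canonicalOneForm I M) α =ᶠ[𝓝 (extChartAt (I.prod 𝓘(ℝ, V →L[ℝ] ℝ)) α α)]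
      fun z : V × (V →L[ℝ] ℝ) => ContinuousAlternatingMap.ofSubsingleton ℝ
        (V × (V →L[ℝ] ℝ)) ℝ (0 : Fin 1) (z.2.comp (ContinuousLinearMap.fst ℝ V (V →L[ℝ] ℝ))) := by
    filter_upwards [extChartAt_target_mem_nhds (I := I.prod 𝓘(ℝ, V →L[ℝ] ℝ)) α] with y hy
    exact inChart_canonicalOneForm α hy
  rw [canonicalTwoForm, extDerivOneForm, mfderiv_extChartAt_self, hev.extDeriv_eq]
  exact extDeriv_tautological _ w₁ w₂

end Cotangent

/-! ### The right Maurer-Cartan form and its structure equation. -/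

/-- Differentiating `F w (Dρ(w) (D₁M(e, w) v)) = v` in `w` at `e` and antisymmetrizing: the second
derivative of `ρ` drops out by symmetry. -/
theorem antisymm_of_hasFDerivAt {V : Type*} [NormedAddCommGroup V] [NormedSpace ℝ V] {e : V}
    {F : V → V →L[ℝ] V} {a' : V →L[ℝ] V →L[ℝ] V} {T : V →L[ℝ] V} {ρ : V → V} {M : V × V → V}
    (hF : HasFDerivAt F (a'.comp T) e) (hρ : ContDiffAt ℝ 2 ρ e) (hM : ContDiffAt ℝ 2 M (e, e))
    (hT : HasFDerivAt ρ T e) (hM1 : ∀ v, fderiv ℝ M (e, e) (v, 0) = v)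
    (hFT : ∀ v, F e (T v) = v)
    (h : ∀ v, ∀ᶠ w in 𝓝 e, F w (fderiv ℝ ρ w (fderiv ℝ M (e, w) (v, 0))) = v) (u v : V) :
    a' (T u) (T v) - a' (T v) (T u) =
      -(fderiv ℝ (fderiv ℝ M) (e, e) (0, u) (v, 0) -
        fderiv ℝ (fderiv ℝ M) (e, e) (u, 0) (0, v)) := by
  have sM : IsSymmSndFDerivAt ℝ M (e, e) := hM.isSymmSndFDerivAt (by simp)
  have sρ : IsSymmSndFDerivAt ℝ ρ e := hρ.isSymmSndFDerivAt (by simp)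
  have dM := ((hM.fderiv_right (m := 1) one_add_one_eq_two.le).differentiableAt
    one_ne_zero).hasFDerivAt
  have dρ := ((hρ.fderiv_right (m := 1) one_add_one_eq_two.le).differentiableAt
    one_ne_zero).hasFDerivAt
  have key : ∀ u v : V, a' (T u) (T v) + (F e (fderiv ℝ (fderiv ℝ ρ) e u v) +
      fderiv ℝ (fderiv ℝ M) (e, e) (0, u) (v, 0)) = 0 := by
    intro u v
    have h1 := (dM.comp e (hasFDerivAt_prodMk_right (𝕜 := ℝ) e e)).clm_apply
      (hasFDerivAt_const ((v, 0) : V × V) e)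
    have h2 := hF.clm_apply (dρ.clm_apply h1)
    have h3 := DFunLike.congr_fun (h2.unique ((hasFDerivAt_const v e).congr_of_eventuallyEq
      (h v))) u
    simp [hM1, hT.fderiv, hFT] at h3
    exact (by abel : _ = _).trans h3
  have e1 := key u v
  have e2 := key v u
  rw [sρ.eq v u, sM.eq (0, v) (u, 0)] at e2
  rw [eq_neg_of_add_eq_zero_left e1, eq_neg_of_add_eq_zero_left e2]
  abel

section LieGroup

variable {E : Type*} [NormedAddCommGroup E] [NormedSpace ℝ E]
  {G : Type*} [TopologicalSpace G] [ChartedSpace E G] [Group G]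

/-- The right Maurer-Cartan form, read in the preferred chart at `g₀`. -/
def mcForm (g₀ g : G) : E →L[ℝ] E :=
  (show E →L[ℝ] E from TRinv g).comp (show E →L[ℝ] E from
    mfderiv 𝓘(ℝ, E) 𝓘(ℝ, E) (extChartAt 𝓘(ℝ, E) g₀).symm (extChartAt 𝓘(ℝ, E) g₀ g))

/-- The derivative at `g` of the right Maurer-Cartan form in the preferred chart at `g`. -/
def mcDeriv (g : G) : E →L[ℝ] E →L[ℝ] E :=
  mfderiv 𝓘(ℝ, E) 𝓘(ℝ, E →L[ℝ] E) (mcForm (E := E) g) g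

/-- Right translation by `g₀`, read in the preferred charts at `1` and `g₀`. -/
def chartRight (g₀ : G) (z : E) : E :=
  extChartAt 𝓘(ℝ, E) g₀ ((extChartAt 𝓘(ℝ, E) (1 : G)).symm z * g₀)

variable [LieGroup 𝓘(ℝ, E) ∞ G]

theorem mcForm_self (g : G) : mcForm g g = (show E →L[ℝ] E from TRinv g) := by
  have := (hasMFDerivAt_extChartAt_symm_self E g).mfderiv
  rw [mcForm, this]
  rfl

theorem mfderiv_extChartAt_of_eq {x y : G} (h : y = x) :
    (show E →L[ℝ] E from mfderiv 𝓘(ℝ, E) 𝓘(ℝ, E) (extChartAt 𝓘(ℝ, E) x) y) =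
      ContinuousLinearMap.id ℝ E := by
  subst h
  exact (hasMFDerivAt_extChartAt_self E y).mfderiv

variable (E) in
-- The form is the tangent map of `h ↦ h x⁻¹` at `h = x`, hence depends smoothly on `x`. Its values
-- all lie over `x x⁻¹ = 1`, so the target needs no change of coordinates.
theorem mdifferentiableAt_mcForm (g₀ : G) :
    MDifferentiableAt 𝓘(ℝ, E) 𝓘(ℝ, E →L[ℝ] E) (mcForm (E := E) g₀) g₀ := by
  have : IsManifold 𝓘(ℝ, E) 1 G := IsManifold.of_le (n := ∞) (by simp)
  have hs : ContMDiff (𝓘(ℝ, E).prod 𝓘(ℝ, E)) 𝓘(ℝ, E) ∞ (fun p : G × G => p.2 * p.1⁻¹) := by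
    have := LieGroup.toContMDiffMul (I := 𝓘(ℝ, E)) (n := ∞) (G := G)
    exact contMDiff_snd.mul contMDiff_fst.inv
  have h := ContMDiffAt.mfderiv (I := 𝓘(ℝ, E)) (I' := 𝓘(ℝ, E)) (J := 𝓘(ℝ, E)) (x₀ := g₀)
    (fun x h : G => h * x⁻¹) id (m := 1) (n := ∞) hs.contMDiffAt contMDiffAt_id
    (by rw [one_add_one_eq_two]; exact two_le_infty)
  refine (h.mdifferentiableAt one_ne_zero).congr_of_eventuallyEq ?_
  filter_upwards [chart_source_mem_nhds E g₀] with g hg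
  refine Eq.trans ?_ (inTangentCoordinates_eq_mfderiv_comp (I := 𝓘(ℝ, E)) (I' := 𝓘(ℝ, E))
    (f := id) (g := fun x : G => x * x⁻¹) (ϕ := fun x : G => TRinv x) (x₀ := g₀) (x := g)
    hg (by simp)).symm
  have h1 := mfderiv_extChartAt_of_eq (E := E)
    ((mul_inv_cancel g).trans (mul_inv_cancel g₀).symm)
  simp only [modelWithCornersSelf_coe, Set.range_id, mfderivWithin_univ]
  exact (congrArg (fun L : E →L[ℝ] E => L.comp (mcForm g₀ g)) h1).symm

theorem contDiffAt_chartRight (g₀ : G) :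
    ContDiffAt ℝ ∞ (chartRight (E := E) g₀) (chartOne E G) := by
  have h1 := contMDiffAt_extChartAt_symm_self (E := E) (1 : G)
  have h2 := (contMDiff_mul_right (I := 𝓘(ℝ, E)) (n := ∞) (a := g₀)).contMDiffAt (x := (1 : G))
  refine ContMDiffAt.contDiffAt (ContMDiffAt.comp (I' := 𝓘(ℝ, E)) _ ?_
    (ContMDiffAt.comp_of_eq h2 h1 (extChartAt_symm_chartOne E G)))
  simp only [extChartAt_symm_chartOne, one_mul]
  exact contMDiffAt_extChartAt

theorem fderiv_chartRight (g₀ : G) :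
    HasFDerivAt (chartRight (E := E) g₀) (TR g₀ : E →L[ℝ] E) (chartOne E G) := by
  have h1 := hasMFDerivAt_extChartAt_symm_self E (1 : G)
  have h2 := (mdifferentiableAt_mul_right E g₀ 1).hasMFDerivAt
  have h4 := hasMFDerivAt_comp_of_eq h2 h1 (extChartAt_symm_chartOne E G)
  exact (hasMFDerivAt_comp_of_eq (hasMFDerivAt_extChartAt_self E g₀) h4 (by simp)).hasFDerivAt

/-- The Maurer-Cartan form sends the right-invariant vector field of `v` to `v`. -/
theorem eventually_mcForm_chartRight (g₀ : G) (v : E) : ∀ᶠ w in 𝓝 (chartOne E G),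
    mcForm g₀ ((extChartAt 𝓘(ℝ, E) (1 : G)).symm w * g₀) (fderiv ℝ (chartRight (E := E) g₀) w
      (fderiv ℝ (chartMul E G) (chartOne E G, w) (v, 0))) = v := by
  have : IsManifold 𝓘(ℝ, E) 1 G := IsManifold.of_le (n := ∞) (by simp)
  have c2 : Tendsto (fun x => (chartOne E G, x)) (𝓝 (chartOne E G))
      (𝓝 (chartOne E G, chartOne E G)) := (Continuous.prodMk_right _).tendsto _
  have c1 : ContinuousAt (extChartAt 𝓘(ℝ, E) (1 : G)).symm (chartOne E G) :=
    (hasMFDerivAt_extChartAt_symm_self E (1 : G)).1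
  have c3 : ∀ᶠ w in 𝓝 (chartOne E G), (extChartAt 𝓘(ℝ, E) (1 : G)).symm w * g₀ ∈
      (extChartAt 𝓘(ℝ, E) g₀).source := by
    refine (ContinuousAt.comp_of_eq (mdifferentiableAt_mul_right E g₀ 1).continuousAt c1
      (extChartAt_symm_chartOne E G)).eventually_mem ?_
    rw [Function.comp_apply, extChartAt_symm_chartOne, one_mul]
    exact extChartAt_source_mem_nhds (I := 𝓘(ℝ, E)) g₀
  filter_upwards [extChartAt_target_mem_nhds (I := 𝓘(ℝ, E)) (1 : G),
    c2.eventually (eventually_contDiffAt_chartMul E G),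
    ((contDiffAt_chartRight (E := E) g₀).of_le two_le_infty).eventually (by simp), c3]
    with w hw hM hR hg
  set x := (extChartAt 𝓘(ℝ, E) (1 : G)).symm w with hx
  have h1 := hasMFDerivAt_extChartAt_symm_self E (1 : G)
  have h2 := hasMFDerivAt_comp_of_eq (mdifferentiableAt_mul_right E (x * g₀) 1).hasMFDerivAt h1
    (extChartAt_symm_chartOne E G)
  have h3 := (mdifferentiableAt_extChartAt (I := 𝓘(ℝ, E)) (x := g₀) (y := x * g₀)
    (by rwa [extChartAt_source] at hg)).hasMFDerivAt
  -- The map `z ↦ z x g₀` in coordinates is differentiated in two ways: directly as right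
  -- translation by `x g₀`, and as `chartMul` followed by `chartRight`.
  have h4 := (hasMFDerivAt_comp_of_eq h3 h2
    ((congrArg (· * (x * g₀)) (extChartAt_symm_chartOne E G)).trans (one_mul _))).hasFDerivAt
  have h5 := (hM.differentiableAt (by simp)).hasFDerivAt.comp (chartOne E G)
    (hasFDerivAt_prodMk_left (𝕜 := ℝ) (chartOne E G) w)
  have h6 := HasFDerivAt.comp (g := chartRight (E := E) g₀) (chartOne E G)
    (by rw [Function.comp_apply, chartMul_chartOne_left hw]
        exact (hR.differentiableAt (by simp)).hasFDerivAt) h5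
  have hs : ∀ᶠ z in 𝓝 (chartOne E G), (extChartAt 𝓘(ℝ, E) (1 : G)).symm z * x ∈
      (extChartAt 𝓘(ℝ, E) (1 : G)).source := by
    refine (ContinuousAt.comp_of_eq (mdifferentiableAt_mul_right E x 1).continuousAt c1
      (extChartAt_symm_chartOne E G)).eventually_mem ?_
    rw [Function.comp_apply, extChartAt_symm_chartOne, one_mul]
    exact extChartAt_source_mem_nhds' (I := 𝓘(ℝ, E))
      ((extChartAt 𝓘(ℝ, E) (1 : G)).map_target hw)
  have h7 := DFunLike.congr_fun (h6.unique (h4.congr_of_eventuallyEq (by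
    filter_upwards [hs] with z hz
    simp only [Function.comp_apply, chartRight, chartMul]
    rw [(extChartAt 𝓘(ℝ, E) (1 : G)).left_inv hz, mul_assoc]))) v
  -- The inverse-chart factor of `mcForm` cancels the chart derivative, leaving `TRinv` applied to
  -- `TR`.
  have h8 := mfderivWithin_extChartAt_symm_comp_mfderiv_extChartAt' (I := 𝓘(ℝ, E)) hg
  rw [modelWithCornersSelf_coe, Set.range_id, mfderivWithin_univ] at h8
  have h9 := DFunLike.congr_fun h8 (TR (x * g₀) v)
  refine (congrArg (mcForm g₀ (x * g₀)) h7).trans ?_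
  exact (congrArg (TRinv (x * g₀)) h9).trans (TRinv_TR (x * g₀) v)

theorem fderiv_chartMul_inl (v : E) :
    fderiv ℝ (chartMul E G) (chartOne E G, chartOne E G) (v, 0) = v := by
  have h := (eventually_fderiv_chartMul_Ad (E := E) (G := G) v).self_of_nhds
  rw [fderiv_chartMul_inr, extChartAt_symm_chartOne] at h
  exact h.symm.trans (Ad_one v)

/-- The Maurer-Cartan equation. -/
theorem mcDeriv_antisymm (g₀ : G) (u v : LieAlg G E) :
    mcDeriv (E := E) g₀ (TR g₀ u) (TR g₀ v) - mcDeriv (E := E) g₀ (TR g₀ v) (TR g₀ u) =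
      -ad G u v := by
  have hF := (hasMFDerivAt_comp_of_eq (mdifferentiableAt_mcForm E g₀).hasMFDerivAt
    (hasMFDerivAt_comp_of_eq (mdifferentiableAt_mul_right E g₀ 1).hasMFDerivAt
      (hasMFDerivAt_extChartAt_symm_self E (1 : G)) (extChartAt_symm_chartOne E G))
    ((congrArg (· * g₀) (extChartAt_symm_chartOne E G)).trans (one_mul _))).hasFDerivAt
  rw [ad_eq_fderiv_fderiv]
  refine antisymm_of_hasFDerivAt (a' := mcDeriv g₀) (T := TR g₀) hF 
    ((contDiffAt_chartRight g₀).of_le two_le_infty) ((contDiffAt_chartMul E G).of_le two_le_infty)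
    (fderiv_chartRight g₀) fderiv_chartMul_inl
    (fun v => ?_) (fun v => eventually_mcForm_chartRight g₀ v) u v
  have e : mcForm g₀ ((extChartAt 𝓘(ℝ, E) (1 : G)).symm (chartOne E G) * g₀) =
      (show E →L[ℝ] E from TRinv g₀) := by
    rw [extChartAt_symm_chartOne, one_mul, mcForm_self]
  exact (DFunLike.congr_fun e (TR g₀ v : E)).trans (TRinv_TR g₀ v)

end LieGroup

/-! ### The derivative of the inverse trivialization. -/

section LieGroup

variable {E : Type*} [NormedAddCommGroup E] [NormedSpace ℝ E]
  {G : Type*} [TopologicalSpace G] [ChartedSpace E G] [Group G]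

/-- The covector `((μ - ad*_ξ ν) ∘ A, ν)` on `E × E`, for `z = (A, ξ, μ, ν)`. -/
def covectorOf (b : E →L[ℝ] E →L[ℝ] E)
    (z : (E →L[ℝ] E) × E × (E →L[ℝ] ℝ) × (E →L[ℝ] ℝ)) : E × E →L[ℝ] ℝ :=
  ((z.2.2.1 - z.2.2.2.comp (b z.2.1)).comp z.1).comp (ContinuousLinearMap.fst ℝ E E) +
    z.2.2.2.comp (ContinuousLinearMap.snd ℝ E E)

/-- The product rule in the four variables; only the values of the derivative are used later, so the
operator itself stays existential. -/
theorem exists_hasFDerivAt_covectorOf (b : E →L[ℝ] E →L[ℝ] E)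
    (z : (E →L[ℝ] E) × E × (E →L[ℝ] ℝ) × (E →L[ℝ] ℝ)) :
    ∃ D : (E →L[ℝ] E) × E × (E →L[ℝ] ℝ) × (E →L[ℝ] ℝ) →L[ℝ] (E × E →L[ℝ] ℝ),
      HasFDerivAt (covectorOf b) D z ∧ ∀ w x, D w x =
        w.2.2.1 (z.1 x.1) - z.2.2.2 (b w.2.1 (z.1 x.1)) - w.2.2.2 (b z.2.1 (z.1 x.1)) +
          (z.2.2.1 (w.1 x.1) - z.2.2.2 (b z.2.1 (w.1 x.1))) + w.2.2.2 x.2 := by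
  have hA := hasFDerivAt_fst (𝕜 := ℝ) (p := z)
  have h2 := hasFDerivAt_snd (𝕜 := ℝ) (p := z)
  have hξ := h2.fst
  have hμ := h2.snd.fst
  have hν := h2.snd.snd
  have h := (((hμ.sub (hν.clm_comp (b.hasFDerivAt.comp z hξ))).clm_comp hA).clm_comp
    (hasFDerivAt_const (ContinuousLinearMap.fst ℝ E E) z)).add
    (hν.clm_comp (hasFDerivAt_const (ContinuousLinearMap.snd ℝ E E) z))
  refine ⟨_, h, fun w x => ?_⟩
  simp only [add_apply, ContinuousLinearMap.comp_apply,
    sub_apply, Pi.sub_apply, ContinuousLinearMap.compL_apply,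
    ContinuousLinearMap.flip_apply, zero_apply, ContinuousLinearMap.comp_zero,
    ContinuousLinearMap.coe_fst', ContinuousLinearMap.coe_snd', Function.comp_apply]
  ring

theorem extChartAt_tangentGroup_symm_mfderiv [LieGroup 𝓘(ℝ, E) ∞ G] (p q : TangentGroup E G)
    (h : q.1 ∈ (extChartAt 𝓘(ℝ, E) p.1).source) :
    HasMFDerivAt 𝓘(ℝ, E × E) (tgModel E) (extChartAt (tgModel E) p).symm
      (extChartAt (tgModel E) p q)
      (ContinuousLinearMap.prodMap (show E →L[ℝ] E from
        mfderiv 𝓘(ℝ, E) 𝓘(ℝ, E) (extChartAt 𝓘(ℝ, E) p.1).symm (extChartAt 𝓘(ℝ, E) p.1 q.1))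
        (ContinuousLinearMap.id ℝ E)) := by
  have : IsManifold 𝓘(ℝ, E) 1 G := IsManifold.of_le (n := ∞) (by simp)
  have h1 := ((mdifferentiableWithinAt_extChartAt_symm (I := 𝓘(ℝ, E)) (x := p.1)
    ((extChartAt 𝓘(ℝ, E) p.1).map_source h)).mdifferentiableAt
    (by rw [modelWithCornersSelf_coe, Set.range_id]; exact univ_mem)).hasMFDerivAt
  have h2 := hasMFDerivAt_comp_of_eq h1 (hasFDerivAt_fst (𝕜 := ℝ)
    (p := (extChartAt 𝓘(ℝ, E) p.1 q.1, q.2))).hasMFDerivAt rfl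
  have h3 := (hasFDerivAt_snd (𝕜 := ℝ)
    (p := (extChartAt 𝓘(ℝ, E) p.1 q.1, q.2))).hasMFDerivAt
  exact h2.prodMk h3

variable [LieGroup 𝓘(ℝ, E) ∞ G]

/-- The trivialization in the preferred bundle chart at the image of `p`. -/
theorem extChartAt_trivialization_symm (p q : Triv E G)
    (h : q.1.1 ∈ (extChartAt 𝓘(ℝ, E) p.1.1).source) :
    extChartAt (ctModel E) (trivialization.symm p) (trivialization.symm q) =
      (extChartAt (tgModel E) p.1 q.1,
        covectorOf (ad G) (mcForm p.1.1 q.1.1, q.1.2, q.2.1, q.2.2)) := by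
  have h0 : q.1 ∈ (chartAt (ModelProd E E) p.1).source := by
    exact ⟨by rwa [extChartAt_source] at h, mem_univ _⟩
  refine (extChartAt_cotangent (I := tgModel E) (trivialization.symm p) (trivialization.symm q)
    h0).trans (Prod.ext rfl ?_)
  have h1 := (extChartAt_tangentGroup_symm_mfderiv p.1 q.1 h).mfderiv
  refine (congrArg (fun L : E × E →L[ℝ] E × E => (show E × E →L[ℝ] ℝ from
    (trivialization.symm q).snd).comp L) h1).trans ?_
  refine ContinuousLinearMap.ext fun x => ?_
  rfl

/-- The derivative, at `p` in the direction `w`, of the covector part of the inverse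
trivialization read in the bundle chart at the image of `p`, evaluated at `x`. -/
def covectorDeriv (p : Triv E G) (w : (E × E) × ((E →L[ℝ] ℝ) × (E →L[ℝ] ℝ))) (x : E × E) : ℝ :=
  w.2.1 (TRinv p.1.1 x.1) - p.2.2 (ad G w.1.2 (TRinv p.1.1 x.1)) -
    w.2.2 (ad G p.1.2 (TRinv p.1.1 x.1)) +
    (p.2.1 (mcDeriv p.1.1 w.1.1 x.1) -
      p.2.2 (ad G p.1.2 (mcDeriv p.1.1 w.1.1 x.1))) +
    w.2.2 x.2

/-- The derivative of the covector part of the trivialization in a chart. -/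
theorem exists_hasMFDerivAt_covectorOf (p : Triv E G) :
    ∃ D : (E × E) × ((E →L[ℝ] ℝ) × (E →L[ℝ] ℝ)) →L[ℝ] (E × E →L[ℝ] ℝ),
      HasMFDerivAt (trivModel E) 𝓘(ℝ, E × E →L[ℝ] ℝ) (fun q : Triv E G =>
        covectorOf (ad G) (mcForm p.1.1 q.1.1, q.1.2, q.2.1, q.2.2)) p D ∧
      ∀ w x, D w x = covectorDeriv p w x := by
  obtain ⟨p1, p2, p3, p4⟩ := hasMFDerivAt_triv_proj E G p
  have a1 := hasMFDerivAt_comp_of_eq (mdifferentiableAt_mcForm E p.1.1).hasMFDerivAt p1 rfl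
  have h := hasMFDerivAt_prodMk_space a1 (hasMFDerivAt_prodMk_space p2
    (hasMFDerivAt_prodMk_space p3 p4))
  obtain ⟨D, hD, hD'⟩ := exists_hasFDerivAt_covectorOf (ad G : E →L[ℝ] E →L[ℝ] E)
    (mcForm p.1.1 p.1.1, p.1.2, p.2.1, p.2.2)
  refine ⟨_, hasMFDerivAt_comp_of_eq hD.hasMFDerivAt h rfl, fun w x => ?_⟩
  refine (hD' _ x).trans ?_
  rw [mcForm_self]
  rfl

theorem mdifferentiableAt_trivialization_symm (p : Triv E G) :
    MDifferentiableAt (trivModel E) (ctModel E)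
      (trivialization.symm : Triv E G → CotangentBundle (tgModel E) (TangentGroup E G)) p := by
  obtain ⟨D, hD, -⟩ := exists_hasMFDerivAt_covectorOf p
  refine (mdifferentiableAt_hom_bundle _).2 ⟨mdifferentiableAt_fst, ?_⟩
  refine hD.mdifferentiableAt.congr_of_eventuallyEq ?_
  filter_upwards [eventually_mem_chart_source E p] with q hq
  exact congrArg Prod.snd (extChartAt_trivialization_symm p q hq)

/-- The derivative of the inverse trivialization, in the preferred bundle chart. -/
theorem mfderiv_trivialization_symm (p : Triv E G) (w : (E × E) × ((E →L[ℝ] ℝ) × (E →L[ℝ] ℝ))) :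
    ∃ κ : E × E →L[ℝ] ℝ, mfderiv (trivModel E) (ctModel E)
      (trivialization.symm : Triv E G → CotangentBundle (tgModel E) (TangentGroup E G)) p w =
        (w.1, κ) ∧ ∀ x, κ x = covectorDeriv p w x := by
  obtain ⟨D, hD, hD'⟩ := exists_hasMFDerivAt_covectorOf p
  refine ⟨D w, ?_, hD' w⟩
  have i1 := isManifold_cotangentBundle (I := tgModel E) (M := TangentGroup E G)
  have i2 : IsManifold (tgModel E) 1 (TangentGroup E G) := IsManifold.of_le (n := ∞) (by simp)
  have e1 := mfderiv_extChartAt_self (I := tgModel E) (x := p.1)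
  have e2 := mfderiv_extChartAt_self (I := ctModel E) (x := (trivialization.symm p :
    CotangentBundle (tgModel E) (TangentGroup E G)))
  have h1 := (mdifferentiableAt_extChartAt (I := tgModel E)
    (mem_chart_source (ModelProd E E) p.1)).hasMFDerivAt
  have h2 := (mdifferentiableAt_extChartAt (I := ctModel E)
    (mem_chart_source (ModelProd (ModelProd E E) (E × E →L[ℝ] ℝ)) (trivialization.symm p :
    CotangentBundle (tgModel E) (TangentGroup E G)))).hasMFDerivAt
  rw [e1] at h1
  rw [e2] at h2
  -- Both charts have identity derivative at their centres, so the intrinsic derivative equals that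
  -- of the coordinate expression.
  have h3 := hasMFDerivAt_comp_of_eq h2 (mdifferentiableAt_trivialization_symm p).hasMFDerivAt rfl
  have h4 := hasMFDerivAt_prodMk_space (hasMFDerivAt_comp_of_eq h1 (hasMFDerivAt_fst p) rfl) hD
  have h5 := hasMFDerivAt_unique h3 (h4.congr_of_eventuallyEq (by
    filter_upwards [eventually_mem_chart_source E p] with q hq
    exact extChartAt_trivialization_symm p q hq))
  exact DFunLike.congr_fun h5 w

end LieGroup

/-! ### The one-form and two-form on right-invariant fields. -/

section LieGroup

variable {E : Type*} [NormedAddCommGroup E] [NormedSpace ℝ E]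
  {G : Type*} [TopologicalSpace G] [ChartedSpace E G] [Group G] [LieGroup 𝓘(ℝ, E) ∞ G]

theorem trivOneForm_apply (p : Triv E G) (w : (E × E) × ((E →L[ℝ] ℝ) × (E →L[ℝ] ℝ))) :
    trivOneForm E G p w =
      p.2.1 (TRinv p.1.1 w.1.1) - p.2.2 (ad G p.1.2 (TRinv p.1.1 w.1.1)) + p.2.2 w.1.2 := by
  obtain ⟨κ, h, -⟩ := mfderiv_trivialization_symm p w
  refine (congrArg (canonicalOneForm (tgModel E) (TangentGroup E G) (trivialization.symm p))
    h).trans ?_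
  exact canonicalOneForm_apply _ _

/-- The term `-⟨ν, [ξ, η]⟩` from the inverse trivialization cancels the `[ξ, η]` in the second
component of the field. -/
theorem trivOneForm_rightInvariantField (η ζ : LieAlg G E) (l₁ l₂ : LieAlgDual G E)
    (g : G) (ξ : LieAlg G E) (μ ν : LieAlgDual G E) :
    trivOneForm E G ((g, ξ), (μ, ν)) (rightInvariantField η ζ l₁ l₂ ((g, ξ), (μ, ν))) =
      μ η + ν ζ := by
  rw [rightInvariantField_apply]
  refine (trivOneForm_apply _ _).trans ?_
  simp only
  erw [TRinv_TR g η]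
  rw [map_add]
  ring

theorem trivTwoForm_apply (p : Triv E G) (w w' : (E × E) × ((E →L[ℝ] ℝ) × (E →L[ℝ] ℝ))) :
    trivTwoForm E G p ![w, w'] = covectorDeriv p w w'.1 - covectorDeriv p w' w.1 := by
  obtain ⟨κ, h, hκ⟩ := mfderiv_trivialization_symm p w
  obtain ⟨κ', h', hκ'⟩ := mfderiv_trivialization_symm p w'
  rw [trivTwoForm, ← hκ, ← hκ']
  have e : (mfderiv (trivModel E) (ctModel E)
      (trivialization.symm : Triv E G → CotangentBundle (tgModel E) (TangentGroup E G)) p) ∘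
      ![w, w'] = ![(w.1, κ), (w'.1, κ')] := by
    funext i
    fin_cases i
    · exact h
    · exact h'
  refine (congrArg (canonicalTwoForm (tgModel E) (TangentGroup E G) (trivialization.symm p))
    e).trans ?_
  exact canonicalTwoForm_apply _ _ _

theorem trivTwoForm_rightInvariantField (η ζ : LieAlg G E) (l₁ l₂ : LieAlgDual G E)
    (η' ζ' : LieAlg G E) (l₁' l₂' : LieAlgDual G E)
    (g : G) (ξ : LieAlg G E) (μ ν : LieAlgDual G E) :
    trivTwoForm E G ((g, ξ), (μ, ν))
        ![rightInvariantField η ζ l₁ l₂ ((g, ξ), (μ, ν)),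
          rightInvariantField η' ζ' l₁' l₂' ((g, ξ), (μ, ν))] =
      l₁ η' + l₂ ζ' - l₁' η - l₂' ζ + μ (ad G η η') + ν (ad G η ζ' - ad G η' ζ) := by
  rw [rightInvariantField_apply, rightInvariantField_apply]
  refine (trivTwoForm_apply _ _ _).trans ?_
  -- `mcDeriv` enters with its arguments in both orders and opposite signs, so the Maurer-Cartan
  -- equation eliminates it.
  have hm := eq_add_of_sub_eq (mcDeriv_antisymm g η η')
  simp only [covectorDeriv]
  erw [hm, TRinv_TR g η, TRinv_TR g η']
  simp only [map_add, map_sub, map_neg, add_apply, adStar, ContinuousLinearMap.comp_apply]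
  -- The double brackets involving `ξ`, all paired with `ν`, cancel by the Jacobi identity.
  rw [ad_ad ξ η η', ad_skew (ad G ξ η') η, ad_skew η' η]
  simp only [map_add, map_neg]
  ring

end LieGroup

/-! ### Hamiltonian vector fields and their integral curves. -/

theorem hasMFDerivWithinAt_comp_of_hasMFDerivAt {V₁ V₂ V₃ H₁ H₂ H₃ M₁ M₂ M₃ : Type*}
    [NormedAddCommGroup V₁] [NormedSpace ℝ V₁] [NormedAddCommGroup V₂] [NormedSpace ℝ V₂]
    [NormedAddCommGroup V₃] [NormedSpace ℝ V₃] [TopologicalSpace H₁] [TopologicalSpace H₂]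
    [TopologicalSpace H₃] [TopologicalSpace M₁] [TopologicalSpace M₂] [TopologicalSpace M₃]
    [ChartedSpace H₁ M₁] [ChartedSpace H₂ M₂] [ChartedSpace H₃ M₃]
    {I₁ : ModelWithCorners ℝ V₁ H₁} {I₂ : ModelWithCorners ℝ V₂ H₂}
    {I₃ : ModelWithCorners ℝ V₃ H₃} {u : M₂ → M₃} {f : M₁ → M₂} {x : M₁} {s : Set M₁}
    {u' : V₂ →L[ℝ] V₃} {f' : V₁ →L[ℝ] V₂} (hu : HasMFDerivAt I₂ I₃ u (f x) u')
    (hf : HasMFDerivWithinAt I₁ I₂ f s x f') :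
    HasMFDerivWithinAt I₁ I₃ (fun z => u (f z)) s x (u'.comp f') :=
  hu.comp_hasMFDerivWithinAt x hf

theorem hasMFDerivWithinAt_iff_hasDerivWithinAt {F : Type*} [NormedAddCommGroup F]
    [NormedSpace ℝ F] {f : ℝ → F} {f' : F} {s : Set ℝ} {t : ℝ} :
    HasMFDerivWithinAt 𝓘(ℝ, ℝ) 𝓘(ℝ, F) f s t ((1 : ℝ →L[ℝ] ℝ).smulRight f') ↔
      HasDerivWithinAt f f' s t := by
  have e : (1 : ℝ →L[ℝ] ℝ).smulRight f' = ContinuousLinearMap.toSpanSingleton ℝ f' := by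
    ext
    simp
  rw [hasDerivWithinAt_iff_hasFDerivWithinAt, ← e]
  exact hasMFDerivWithinAt_iff_hasFDerivWithinAt

section LieGroup

variable {E : Type*} [NormedAddCommGroup E] [NormedSpace ℝ E]
  {G : Type*} [TopologicalSpace G] [ChartedSpace E G]

/-- A curve in `¹T*TG` is differentiable with a given velocity iff its components are. -/
theorem hasMFDerivWithinAt_triv_iff {g : ℝ → G} {ξ : ℝ → E} {μ ν : ℝ → E →L[ℝ] ℝ} {s : Set ℝ}
    {t : ℝ} {v z : E} {l k : E →L[ℝ] ℝ} :
    HasMFDerivWithinAt 𝓘(ℝ, ℝ) (trivModel E) (fun t => (((g t, ξ t), (μ t, ν t)) : Triv E G)) s t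
        ((1 : ℝ →L[ℝ] ℝ).smulRight
          (((v, z), (l, k)) : (E × E) × ((E →L[ℝ] ℝ) × (E →L[ℝ] ℝ)))) ↔
      HasMFDerivWithinAt 𝓘(ℝ, ℝ) 𝓘(ℝ, E) g s t ((1 : ℝ →L[ℝ] ℝ).smulRight v) ∧
      HasDerivWithinAt ξ z s t ∧ HasDerivWithinAt μ l s t ∧ HasDerivWithinAt ν k s t := by
  rw [← hasMFDerivWithinAt_iff_hasDerivWithinAt, ← hasMFDerivWithinAt_iff_hasDerivWithinAt,
    ← hasMFDerivWithinAt_iff_hasDerivWithinAt]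
  constructor
  · intro h
    obtain ⟨p1, p2, p3, p4⟩ := hasMFDerivAt_triv_proj E G ((g t, ξ t), (μ t, ν t))
    exact ⟨hasMFDerivWithinAt_comp_of_hasMFDerivAt
        (f := fun t => (((g t, ξ t), (μ t, ν t)) : Triv E G)) p1 h,
      hasMFDerivWithinAt_comp_of_hasMFDerivAt
        (f := fun t => (((g t, ξ t), (μ t, ν t)) : Triv E G)) p2 h,
      hasMFDerivWithinAt_comp_of_hasMFDerivAt
        (f := fun t => (((g t, ξ t), (μ t, ν t)) : Triv E G)) p3 h,
      hasMFDerivWithinAt_comp_of_hasMFDerivAt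
        (f := fun t => (((g t, ξ t), (μ t, ν t)) : Triv E G)) p4 h⟩
  · rintro ⟨h1, h2, h3, h4⟩
    exact (h1.prodMk h2).prodMk (h3.prodMk h4)

/-- The chain rule along the four coordinate slices through `p`; `apply_bidualToVector` turns the
last two partials into pairings with vectors. -/
theorem mfderiv_eq_partials [FiniteDimensional ℝ E] {H : Triv E G → ℝ} {p : Triv E G}
    (hH : MDifferentiableAt (trivModel E) 𝓘(ℝ, ℝ) H p)
    (w : (E × E) × ((E →L[ℝ] ℝ) × (E →L[ℝ] ℝ))) :
    (mfderiv (trivModel E) 𝓘(ℝ, ℝ) H p w : ℝ) = deltaG H p w.1.1 + deltaXi H p w.1.2 +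
      w.2.1 (deltaMu H p) + w.2.2 (deltaNu H p) := by
  have h := hH.hasMFDerivAt
  have s1 := hasMFDerivAt_comp_of_eq (f := fun g : G => (((g, p.1.2), p.2) : Triv E G)) h
    (((hasMFDerivAt_id (I := 𝓘(ℝ, E)) p.1.1).prodMk
      (hasMFDerivAt_const (I' := 𝓘(ℝ, E)) p.1.2 p.1.1)).prodMk
      (hasMFDerivAt_const (I' := 𝓘(ℝ, E →L[ℝ] ℝ).prod 𝓘(ℝ, E →L[ℝ] ℝ)) p.2 p.1.1)) rfl
  have s2 := hasMFDerivAt_comp_of_eq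
    (f' := ((0 : E →L[ℝ] E).prod (ContinuousLinearMap.id ℝ E)).prod 0)
    (f := fun ξ : E => (((p.1.1, ξ), p.2) : Triv E G)) h
    (((hasMFDerivAt_const (I := 𝓘(ℝ, E)) (I' := 𝓘(ℝ, E)) p.1.1 p.1.2).prodMk
      (hasMFDerivAt_id p.1.2)).prodMk
      (hasMFDerivAt_const (I' := 𝓘(ℝ, E →L[ℝ] ℝ).prod 𝓘(ℝ, E →L[ℝ] ℝ)) p.2 p.1.2)) rfl
  have s3 := hasMFDerivAt_comp_of_eq
    (f' := (0 : (E →L[ℝ] ℝ) →L[ℝ] E × E).prod ((ContinuousLinearMap.id ℝ (E →L[ℝ] ℝ)).prod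
      (0 : (E →L[ℝ] ℝ) →L[ℝ] (E →L[ℝ] ℝ))))
    (f := fun μ : E →L[ℝ] ℝ => ((p.1, (μ, p.2.2)) : Triv E G)) h
    ((hasMFDerivAt_const (I := 𝓘(ℝ, E →L[ℝ] ℝ)) (I' := tgModel E) p.1 p.2.1).prodMk
      ((hasMFDerivAt_id p.2.1).prodMk
      (hasMFDerivAt_const (I' := 𝓘(ℝ, E →L[ℝ] ℝ)) p.2.2 p.2.1))) rfl
  have s4 := hasMFDerivAt_comp_of_eq
    (f' := (0 : (E →L[ℝ] ℝ) →L[ℝ] E × E).prod ((0 : (E →L[ℝ] ℝ) →L[ℝ] (E →L[ℝ] ℝ)).prod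
      (ContinuousLinearMap.id ℝ (E →L[ℝ] ℝ))))
    (f := fun ν : E →L[ℝ] ℝ => ((p.1, (p.2.1, ν)) : Triv E G)) h
    ((hasMFDerivAt_const (I := 𝓘(ℝ, E →L[ℝ] ℝ)) (I' := tgModel E) p.1 p.2.2).prodMk
      ((hasMFDerivAt_const (I' := 𝓘(ℝ, E →L[ℝ] ℝ)) p.2.1 p.2.2).prodMk
      (hasMFDerivAt_id p.2.2))) rfl
  set D : (E × E) × ((E →L[ℝ] ℝ) × (E →L[ℝ] ℝ)) →L[ℝ] ℝ :=
    mfderiv (trivModel E) 𝓘(ℝ, ℝ) H p with hD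
  have f2 : HasFDerivAt (fun ξ : E => H ((p.1.1, ξ), p.2))
    (D.comp (((0 : E →L[ℝ] E).prod (ContinuousLinearMap.id ℝ E)).prod 0)) p.1.2 := s2.hasFDerivAt
  have f3 : HasFDerivAt (fun μ : E →L[ℝ] ℝ => H (p.1, (μ, p.2.2)))
    (D.comp ((0 : (E →L[ℝ] ℝ) →L[ℝ] E × E).prod ((ContinuousLinearMap.id ℝ (E →L[ℝ] ℝ)).prod
      (0 : (E →L[ℝ] ℝ) →L[ℝ] (E →L[ℝ] ℝ))))) p.2.1 := s3.hasFDerivAt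
  have f4 : HasFDerivAt (fun ν : E →L[ℝ] ℝ => H (p.1, (p.2.1, ν)))
    (D.comp ((0 : (E →L[ℝ] ℝ) →L[ℝ] E × E).prod ((0 : (E →L[ℝ] ℝ) →L[ℝ] (E →L[ℝ] ℝ)).prod
      (ContinuousLinearMap.id ℝ (E →L[ℝ] ℝ))))) p.2.2 := s4.hasFDerivAt
  have e1 : deltaG H p w.1.1 = D ((w.1.1, 0), 0) := DFunLike.congr_fun s1.mfderiv w.1.1
  have e2 : deltaXi H p w.1.2 = D ((0, w.1.2), 0) :=
    congrArg (fun L : E →L[ℝ] ℝ => L w.1.2) f2.fderiv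
  have e3 : w.2.1 (deltaMu H p) = D (0, (w.2.1, 0)) :=
    (apply_bidualToVector _ _).trans (congrArg (fun L : (E →L[ℝ] ℝ) →L[ℝ] ℝ => L w.2.1) f3.fderiv)
  have e4 : w.2.2 (deltaNu H p) = D (0, (0, w.2.2)) :=
    (apply_bidualToVector _ _).trans (congrArg (fun L : (E →L[ℝ] ℝ) →L[ℝ] ℝ => L w.2.2) f4.fderiv)
  rw [e1, e2, e3, e4, ← map_add, ← map_add, ← map_add]
  exact congrArg D (by simp : w = _)

variable [Group G] [LieGroup 𝓘(ℝ, E) ∞ G]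

/-- The component formula is triangular: the `G`-component fixes `η`, and subtraction then gives
`ζ`, `l₁` and `l₂`. -/
theorem exists_eq_rightInvariantField (p : Triv E G) (w : TangentSpace (trivModel E) p) :
    ∃ (η ζ : LieAlg G E) (l₁ l₂ : LieAlgDual G E), w = rightInvariantField η ζ l₁ l₂ p := by
  obtain ⟨⟨g, ξ⟩, μ, ν⟩ := p
  obtain ⟨⟨v, z⟩, l, k⟩ := (show (E × E) × ((E →L[ℝ] ℝ) × (E →L[ℝ] ℝ)) from w)
  set η : LieAlg G E := TRinv g v with hη
  refine ⟨η, z - ad G ξ η, l - adStar G η μ - adStar G (z - ad G ξ η) ν, k - adStar G η ν, ?_⟩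
  rw [rightInvariantField_apply, TR_TRinv g v]
  refine Prod.ext (Prod.ext rfl ?_) (Prod.ext ?_ ?_)
  · exact (sub_add_cancel z (ad G ξ η)).symm
  · change l = l - adStar G η μ - adStar G (z - ad G ξ η) ν + adStar G η μ +
      adStar G (z - ad G ξ η) ν
    abel
  · exact (sub_add_cancel k (adStar G η ν)).symm

/-- The one-form `dH` on a right-invariant vector field. -/
theorem mfderiv_rightInvariantField [FiniteDimensional ℝ E] {H : Triv E G → ℝ} {p : Triv E G}
    (hH : MDifferentiableAt (trivModel E) 𝓘(ℝ, ℝ) H p)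
    (η ζ : LieAlg G E) (l₁ l₂ : LieAlgDual G E) :
    (mfderiv (trivModel E) 𝓘(ℝ, ℝ) H p (rightInvariantField η ζ l₁ l₂ p) : ℝ) =
      deltaGRight H p η + deltaXi H p (ζ + ad G p.1.2 η) +
      (l₁ + adStar G η p.2.1 + adStar G ζ p.2.2) (deltaMu H p) +
      (l₂ + adStar G η p.2.2) (deltaNu H p) := by
  rw [show rightInvariantField η ζ l₁ l₂ p = _ from
    rightInvariantField_apply η ζ l₁ l₂ p.1.1 p.1.2 p.2.1 p.2.2]
  exact mfderiv_eq_partials hH _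

theorem isHamiltonianField_iff [FiniteDimensional ℝ E] {H : Triv E G → ℝ}
    (hH : MDifferentiable (trivModel E) 𝓘(ℝ, ℝ) H)
    (X : ∀ p : Triv E G, TangentSpace (trivModel E) p) :
    IsHamiltonianField H X ↔ ∀ p, X p = rightInvariantField (deltaMu H p) (deltaNu H p)
      (-deltaGRight H p - adStar G p.1.2 (deltaXi H p)) (-deltaXi H p) p := by
  constructor
  · intro hX p
    obtain ⟨η, ζ, l₁, l₂, hp⟩ := exists_eq_rightInvariantField p (X p)
    have key : ∀ (η' ζ' : LieAlg G E) (l₁' l₂' : LieAlgDual G E),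
        l₁ η' + l₂ ζ' - l₁' η - l₂' ζ + p.2.1 (ad G η η') + p.2.2 (ad G η ζ' - ad G η' ζ) =
        -(deltaGRight H p η' + deltaXi H p (ζ' + ad G p.1.2 η') +
      (l₁' + adStar G η' p.2.1 + adStar G ζ' p.2.2) (deltaMu H p) +
      (l₂' + adStar G η' p.2.2) (deltaNu H p)) := by
      intro η' ζ' l₁' l₂'
      have h := (hX p (rightInvariantField η' ζ' l₁' l₂' p)).trans
        (congrArg (fun x : ℝ => -x) (mfderiv_rightInvariantField (hH p) η' ζ' l₁' l₂'))
      rw [hp] at h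
      exact (trivTwoForm_rightInvariantField η ζ l₁ l₂ η' ζ' l₁' l₂' p.1.1 p.1.2 p.2.1
        p.2.2).symm.trans h
    -- Test generators with a single nonzero slot isolate the unknowns. The vectors `η` and `ζ` come
    -- first, because they are needed to cancel the coadjoint terms in the equations for `l₂` and
    -- `l₁`.
    have hη : η = deltaMu H p := by
      refine (SeparatingDual.eq_iff_forall_dual_eq (R := ℝ)).2 fun l => ?_
      simpa [adStar] using key 0 0 l 0
    have hζ : ζ = deltaNu H p := by
      refine (SeparatingDual.eq_iff_forall_dual_eq (R := ℝ)).2 fun l => ?_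
      simpa [adStar] using key 0 0 0 l
    have hl₂ : l₂ = -deltaXi H p := by
      ext z
      have h := key 0 z 0 0
      simp [adStar, ← hη, ad_skew z η] at h
      simp
      linarith
    have hl₁ : l₁ = -deltaGRight H p - adStar G p.1.2 (deltaXi H p) := by
      ext z
      have h := key z 0 0 0
      simp [adStar, ← hη, ← hζ, ad_skew z η] at h
      simp [adStar]
      linarith
    rw [hp, hη, hζ, hl₁, hl₂]
  · intro hX p w
    obtain ⟨η', ζ', l₁', l₂', rfl⟩ := exists_eq_rightInvariantField p w
    refine Eq.trans ?_ (congrArg (fun x : ℝ => -x)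
      (mfderiv_rightInvariantField (hH p) η' ζ' l₁' l₂')).symm
    rw [hX]
    refine (trivTwoForm_rightInvariantField _ _ _ _ η' ζ' l₁' l₂' p.1.1 p.1.2 p.2.1 p.2.2).trans ?_
    simp [adStar, ad_skew η' (deltaMu H p), ad_skew ζ' (deltaMu H p)]
    ring

end LieGroup

end TrivializedHamilton

end

theorem mainTheorem3 {E : Type*} [NormedAddCommGroup E] [NormedSpace ℝ E] [FiniteDimensional ℝ E]
    {G : Type*} [TopologicalSpace G] [ChartedSpace E G] [Group G] [LieGroup 𝓘(ℝ, E) ∞ G] :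
    -- values of the right-invariant vector fields
    (∀ (η ζ : LieAlg G E) (l₁ l₂ : LieAlgDual G E)
      (g : G) (ξ : LieAlg G E) (μ ν : LieAlgDual G E),
      rightInvariantField η ζ l₁ l₂ ((g, ξ), (μ, ν)) =
        ((TR g η, ζ + ad G ξ η),
          (l₁ + adStar G η μ + adStar G ζ ν,
            l₂ + adStar G η ν))) ∧
    -- values of the canonical one-form on right-invariant vector fields
    (∀ (η ζ : LieAlg G E) (l₁ l₂ : LieAlgDual G E)
      (g : G) (ξ : LieAlg G E) (μ ν : LieAlgDual G E),
      trivOneForm E G ((g, ξ), (μ, ν))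
          (rightInvariantField η ζ l₁ l₂ ((g, ξ), (μ, ν))) =
        μ η + ν ζ) ∧
    -- values of the symplectic two-form on right-invariant vector fields
    (∀ (η ζ : LieAlg G E) (l₁ l₂ : LieAlgDual G E)
      (η' ζ' : LieAlg G E) (l₁' l₂' : LieAlgDual G E)
      (g : G) (ξ : LieAlg G E) (μ ν : LieAlgDual G E),
      trivTwoForm E G ((g, ξ), (μ, ν))
          ![rightInvariantField η ζ l₁ l₂ ((g, ξ), (μ, ν)),
            rightInvariantField η' ζ' l₁' l₂' ((g, ξ), (μ, ν))] =
        l₁ η' + l₂ ζ' - l₁' η - l₂' ζ + μ (ad G η η')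
          + ν (ad G η ζ' - ad G η' ζ)) ∧
    -- Hamiltonian dynamics
    (∀ H : Triv E G → ℝ,
      MDifferentiable (trivModel E) 𝓘(ℝ, ℝ) H →
      -- there is exactly one Hamiltonian vector field, and at each point it is the value of a
      -- right-invariant vector field with the stated generator
      (∀ X : ∀ p : Triv E G,
          TangentSpace (trivModel E) p,
        IsHamiltonianField H X ↔
          ∀ p, X p = rightInvariantField
            (deltaMu H p) (deltaNu H p)
            (-deltaGRight H p
              - adStar G p.1.2 (deltaXi H p))
            (-deltaXi H p) p) ∧
      -- its integral curves are the solutions of the trivialized Hamilton's equations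
      (∀ X : ∀ p : Triv E G,
          TangentSpace (trivModel E) p,
        IsHamiltonianField H X →
        ∀ (s : Set ℝ) (g : ℝ → G) (ξ : ℝ → LieAlg G E)
          (μ ν : ℝ → LieAlgDual G E),
          IsMIntegralCurveOn (I := trivModel E)
              (fun t => (((g t, ξ t), (μ t, ν t)) : Triv E G)) X s ↔
            ∀ t ∈ s,
              HasMFDerivWithinAt 𝓘(ℝ, ℝ) 𝓘(ℝ, E) g s t
                ((1 : ℝ →L[ℝ] ℝ).smulRight (TR (g t)
                  (deltaMu H ((g t, ξ t), (μ t, ν t))))) ∧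
              HasDerivWithinAt ξ
                (deltaNu H ((g t, ξ t), (μ t, ν t))
                  + ad G (ξ t)
                    (deltaMu H ((g t, ξ t), (μ t, ν t)))) s t ∧
              HasDerivWithinAt μ
                (-deltaGRight H ((g t, ξ t), (μ t, ν t))
                  - adStar G (ξ t)
                      (deltaXi H ((g t, ξ t), (μ t, ν t)))
                  + adStar G
                      (deltaMu H ((g t, ξ t), (μ t, ν t))) (μ t)
                  + adStar G
                      (deltaNu H ((g t, ξ t), (μ t, ν t))) (ν t)) s t ∧
              HasDerivWithinAt ν
                (-deltaXi H ((g t, ξ t), (μ t, ν t))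
                  + adStar G
                      (deltaMu H ((g t, ξ t), (μ t, ν t))) (ν t)) s t)) := by
  refine ⟨rightInvariantField_apply, trivOneForm_rightInvariantField,
    trivTwoForm_rightInvariantField, fun H hH => ⟨isHamiltonianField_iff hH,
      fun X hX s g ξ μ ν => forall₂_congr fun t _ => ?_⟩⟩
  -- The components of this right-invariant vector are the right sides of Hamilton's equations, and
  -- a curve in the product is differentiated componentwise.
  rw [(isHamiltonianField_iff hH X).1 hX, rightInvariantField_apply]
  exact hasMFDerivWithinAt_triv_iff
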